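/- Let $d\ge 1$ and let $f$ be any probability density on $\mathbb{R}^d$ (with respect to Lebesgue measure) whose differential entropy $H(f)=-\int f(x)\ln f(x)\,dx$ exists and is finite, i.e. $f\ln f$ is integrable. Let $X,X_1,X_2,\dots$ be identically distributed random vectors with density $f$, where $X_1,X_2,\dots$ are independent, and for $n\ge 2$ let $$H_n=\frac1n\sum_{i=1}^n \ln\bigl((n-1)\,R_{n,i}^d\,v_d\bigr)+C_E,\qquad R_{n,i}=\min_{j\ne i,\ 1\le j\le n}\|X_i-X_j\|,$$ where $\|\cdot\|$ is the Euclidean norm, $v_d$ is the volume of the unit ball of $\mathbb{R}^d$ and $C_E=-\int_0^\infty e^{-t}\ln t\,dt$ is the Euler--Mascheroni constant. Then $$\lim_{n\to\infty}\mathbb{E}\{|H_n-H(f)|\}=0\quad\text{if and only if}\quad \mathbb{E}\{(\ln\|X\|)^+\}<\infty .$$ Moreover, for every $n\ge 2$ the expectation $\mathbb{E}\{H_n\}$ is well defined as an element of $(-\infty,\infty]$ (at least one of $\mathbb{E}\{H_n^+\}$ and $\mathbb{E}\{H_n^-\}$ is finite, and $\mathbb{E}\{H_n\}>-\infty$), and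 if $\mathbb{E}\{(\ln\|X\|)^+\}=\infty$, then $\mathbb{E}\{H_n\}=\infty$ for every $n\ge 2$. -/

import Mathlib

open MeasureTheory ProbabilityTheory Filter
open scoped Topology ENNReal

noncomputable section

/-- `f` is a probability density on `ℝ^d` (with respect to Lebesgue measure). -/
structure IsProbDensity {d : ℕ} (f : EuclideanSpace ℝ (Fin d) → ℝ) : Prop where
  measurable : Measurable f
  nonneg : ∀ x, 0 ≤ f x
  lintegral_eq_one : ∫⁻ x, ENNReal.ofReal (f x) = 1

/-- The differential entropy `H(f)` exists and is finite, that is, `f ln f` is integrable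
(with `0 ln 0 = 0`). -/
def HasFiniteEntropy {d : ℕ} (f : EuclideanSpace ℝ (Fin d) → ℝ) : Prop :=
  Integrable (fun x => f x * Real.log (f x)) volume

/-- The differential entropy `H(f) = - ∫ f ln f`. -/
def diffEntropy {d : ℕ} (f : EuclideanSpace ℝ (Fin d) → ℝ) : ℝ :=
  -∫ x, f x * Real.log (f x)

/-- The constant `C_E = - ∫_0^∞ e^{-t} ln t dt = 0.5772...`. -/
def constCE : ℝ := -∫ t in Set.Ioi (0 : ℝ), Real.exp (-t) * Real.log t

/-- The volume `v_d` of the unit ball of `ℝ^d`. -/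
def unitBallVolume (d : ℕ) : ℝ :=
  (volume (Metric.ball (0 : EuclideanSpace ℝ (Fin d)) 1)).toReal

/-- `R_{n,i}(z) = min_{j ≠ i} ‖z - x_j‖` for a sample `x` of size `n`. For `n ≥ 2` the index set is
finite and non-empty, so the infimum is a minimum. -/
def nnDist {d n : ℕ} (x : Fin n → EuclideanSpace ℝ (Fin d)) (i : Fin n)
    (z : EuclideanSpace ℝ (Fin d)) : ℝ :=
  ⨅ j : {j : Fin n // j ≠ i}, ‖z - x j‖

/-- The nearest neighbor entropy estimate computed from a sample `x` of size `n`, meaningful for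
`n ≥ 2`. Samples with two equal points, where a logarithm would be `-∞`, have probability zero
under a law with a density on `ℝ^d`, `d ≥ 1`. -/
def nnEntropyEstimate {d n : ℕ} (x : Fin n → EuclideanSpace ℝ (Fin d)) : ℝ :=
  (1 / (n : ℝ)) *
      ∑ i : Fin n, Real.log (((n : ℝ) - 1) * nnDist x i (x i) ^ d * unitBallVolume d)
    + constCE

/-- The random variable `H_n`: the estimate computed from the first `n` terms of the sequence
`X`. -/
def estimateH {d : ℕ} {Ω : Type*} (X : ℕ → Ω → EuclideanSpace ℝ (Fin d)) (n : ℕ) (ω : Ω) : ℝ :=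
  nnEntropyEstimate (fun i : Fin n => X i ω)

/-- `E{Y^+}`, possibly infinite. -/
def expPos {Ω : Type*} [MeasurableSpace Ω] (P : Measure Ω) (Y : Ω → ℝ) : ℝ≥0∞ :=
  ∫⁻ ω, ENNReal.ofReal (Y ω) ∂P

/-- `E{Y^-}`, possibly infinite. -/
def expNeg {Ω : Type*} [MeasurableSpace Ω] (P : Measure Ω) (Y : Ω → ℝ) : ℝ≥0∞ :=
  ∫⁻ ω, ENNReal.ofReal (-(Y ω)) ∂P

/-- The expectation of `Y` is well defined as an extended real number: `E{Y^+}` and `E{Y^-}` are not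
both infinite. -/
def ExpWellDefined {Ω : Type*} [MeasurableSpace Ω] (P : Measure Ω) (Y : Ω → ℝ) : Prop :=
  expPos P Y < ⊤ ∨ expNeg P Y < ⊤

/-- The extended expectation `E{Y} = E{Y^+} - E{Y^-}`, meaningful when it is well defined. -/
def extExp {Ω : Type*} [MeasurableSpace Ω] (P : Measure Ω) (Y : Ω → ℝ) : EReal :=
  (expPos P Y : EReal) - (expNeg P Y : EReal)

end

/-!
Write `T_i = (n - 1) R_{n,i}^d v_d` for the normalised nearest neighbor volumes (`nnVolume`) and
`L_i = log T_i`, so that `H_n - C_E` is the mean of the `L_i`. The event `T_i > s` says that no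
other sample point lies in the ball around `X_i` whose volume is `s / (n - 1)`, and conditioning
on `X_i` gives `P(T_i > s) = ∫ (1 - μ(B(x, r)))^(n-1) dμ(x)` (`measure_lt_nnVolume`).

Every real number is `a = ∫ (1_{u < a} - 1_{u < 0}) du`. Hence `H_n - C_E` is the integral over
`u` of `N_n(u) - 1_{u < 0}`, where `N_n(u)` is the fraction of the `L_i` above `u`
(`tailFraction`). Similarly `H(f) - C_E` is the integral of `p(u) - 1_{u < 0}` with
`p(u) = ∫ e^{-e^u f} dμ` (`limitTail`), because `p` is the tail function of `log E - log f(X)` for an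
independent standard exponential `E`. Therefore `𝔼|H_n - H(f)| ≤ ∫ 𝔼|N_n(u) - p(u)| du`, and it is
enough to prove convergence for each `u` and to find an integrable majorant.

* For fixed `u`, Lebesgue differentiation gives `P(L_i > u) → p(u)`. Two distinct shrinking balls
  are eventually disjoint, so pairs of events decouple in the limit and `N_n(u) → p(u)` in `L²`
  (`tendsto_lintegral_tailFraction_sub`).
* For `u < 0`, `P(T ≤ s) ≤ P(f(X) > M) + M s` by Fubini's theorem (`one_le_isolated_add`). With
  `s = e^u` and `M = s^{-1/2}` the integral over `u` is controlled by `∫ f |log f|`.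
* For `u ≥ 0`, `P(T > s) ≤ 2 P(‖X‖ > ρ / 2) + 3^d / √s` with `v_d ρ^d = √s` (`isolated_le`). The
  integral over `u` is finite as soon as `𝔼 log⁺ ‖X‖` is.

The bound for `u < 0` needs only the entropy hypothesis, so `𝔼 H_n⁻ < ∞` always. If
`𝔼 log⁺ ‖X‖ = ∞`, then with positive probability, independently of `X_0`, all other points lie in a fixed ball,
where `R_{n,0} ≥ ‖X_0‖ / 2` for large `‖X_0‖`. Hence `𝔼 L_0⁺ = ∞` (`expPos_log_nnVolume_eq_top`)
and `𝔼 H_n = ∞`, which also rules out convergence in mean.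
-/

/-! ### The layer-cake formula for signed variables -/

/-- The signed layer function `u ↦ 1_{u < a} - 1_{u < 0}`, whose integral over the line is `a`. -/
noncomputable def layer (a u : ℝ) : ℝ :=
  (if u < a then 1 else 0) - (if u < 0 then 1 else 0)

theorem layer_of_nonneg {a : ℝ} (ha : 0 ≤ a) :
    layer a = (Set.Ico 0 a).indicator (fun _ => (1 : ℝ)) := by
  funext u
  simp only [layer, Set.indicator, Set.mem_Ico]
  split_ifs <;> grind

theorem layer_of_nonpos {a : ℝ} (ha : a ≤ 0) :
    layer a = (Set.Ico a 0).indicator (fun _ => (-1 : ℝ)) := by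
  funext u
  simp only [layer, Set.indicator, Set.mem_Ico]
  split_ifs <;> grind

theorem integrable_layer (a : ℝ) : Integrable (layer a) := by
  rcases le_total 0 a with ha | ha
  · rw [layer_of_nonneg ha, integrable_indicator_iff measurableSet_Ico]
    exact integrableOn_const (by simp)
  · rw [layer_of_nonpos ha, integrable_indicator_iff measurableSet_Ico]
    exact integrableOn_const (by simp)

theorem integral_layer (a : ℝ) : ∫ u, layer a u = a := by
  rcases le_total 0 a with ha | ha
  · rw [layer_of_nonneg ha, integral_indicator measurableSet_Ico]
    simp [ha]
  · rw [layer_of_nonpos ha, integral_indicator measurableSet_Ico]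
    simp [ha]

theorem integral_norm_layer (a : ℝ) : ∫ u, ‖layer a u‖ = |a| := by
  rcases le_total 0 a with ha | ha
  · rw [layer_of_nonneg ha]
    simp_rw [norm_indicator_eq_indicator_norm]
    rw [integral_indicator measurableSet_Ico]
    simp [ha, abs_of_nonneg ha]
  · rw [layer_of_nonpos ha]
    simp_rw [norm_indicator_eq_indicator_norm]
    rw [integral_indicator measurableSet_Ico]
    simp [ha, abs_of_nonpos ha]

theorem measurable_layer : Measurable (fun p : ℝ × ℝ => layer p.1 p.2) := by
  unfold layer
  refine Measurable.sub ?_ ?_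
  · exact Measurable.ite (measurableSet_lt measurable_snd measurable_fst)
      measurable_const measurable_const
  · exact Measurable.ite (measurableSet_lt measurable_snd measurable_const)
      measurable_const measurable_const

section LayerCake

variable {α : Type*} [MeasurableSpace α] {ν : Measure α} {Y : α → ℝ}

theorem integral_layer_eq_tail [IsProbabilityMeasure ν] (hY : Measurable Y) (u : ℝ) :
    ∫ ω, layer (Y ω) u ∂ν = ν.real {ω | u < Y ω} - (if u < 0 then 1 else 0) := by
  have hm : MeasurableSet {ω | u < Y ω} := measurableSet_lt measurable_const hY
  have h1 : ∀ ω, layer (Y ω) u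
      = {ω | u < Y ω}.indicator (fun _ => (1 : ℝ)) ω - (if u < 0 then 1 else 0) := by
    intro ω
    simp [layer, Set.indicator]
  simp_rw [h1]
  rw [integral_sub ((integrable_const _).indicator hm) (integrable_const _),
    integral_indicator hm]
  simp

theorem integrable_layer_prod [SFinite ν] (hY : Measurable Y) (hi : Integrable Y ν) :
    Integrable (fun p : α × ℝ => layer (Y p.1) p.2) (ν.prod volume) := by
  have hm : Measurable (fun p : α × ℝ => layer (Y p.1) p.2) :=
    measurable_layer.comp ((hY.comp measurable_fst).prodMk measurable_snd)
  rw [integrable_prod_iff hm.aestronglyMeasurable]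
  refine ⟨Eventually.of_forall fun ω => integrable_layer (Y ω), ?_⟩
  simp_rw [integral_norm_layer]
  exact hi.abs

/-- Layer-cake formula for an integrable real variable of arbitrary sign: the centred tail
function `P(Y > u) - 1_{u < 0}` is integrable. -/
theorem integrable_tail_sub [IsProbabilityMeasure ν] (hY : Measurable Y)
    (hi : Integrable Y ν) :
    Integrable (fun u : ℝ => ν.real {ω | u < Y ω} - (if u < 0 then 1 else 0)) := by
  simp_rw [← integral_layer_eq_tail (ν := ν) hY]
  exact (integrable_layer_prod hY hi).integral_prod_right

/-- Layer-cake formula for an integrable real variable of arbitrary sign. -/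
theorem integral_tail_sub [IsProbabilityMeasure ν] (hY : Measurable Y) (hi : Integrable Y ν) :
    ∫ u : ℝ, (ν.real {ω | u < Y ω} - (if u < 0 then 1 else 0)) = ∫ ω, Y ω ∂ν := by
  simp_rw [← integral_layer_eq_tail (ν := ν) hY]
  rw [integral_integral_swap]
  · simp_rw [integral_layer]
  · exact (integrable_layer_prod hY hi).swap

end LayerCake

/-! ### The standard exponential law and the entropy integral -/

/-- The standard exponential law, with density `e^{-t}` on `(0, ∞)`. -/
noncomputable def stdExp : Measure ℝ :=
  (volume.restrict (Set.Ioi (0 : ℝ))).withDensity (fun t => ENNReal.ofReal (Real.exp (-t)))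

theorem stdExp_Ioi {c : ℝ} (hc : 0 ≤ c) :
    stdExp (Set.Ioi c) = ENNReal.ofReal (Real.exp (-c)) := by
  rw [stdExp, withDensity_apply _ measurableSet_Ioi, Measure.restrict_restrict measurableSet_Ioi,
    Set.Ioi_inter_Ioi, sup_eq_left.2 hc, ← integral_exp_neg_Ioi c,
    ofReal_integral_eq_lintegral_ofReal]
  · exact integrableOn_exp_neg_Ioi c
  · exact Eventually.of_forall fun t => (Real.exp_pos _).le

theorem stdExp_ae_pos : ∀ᵐ t ∂stdExp, 0 < t :=
  (withDensity_absolutelyContinuous _ _).ae_le (ae_restrict_mem measurableSet_Ioi)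

instance isProbabilityMeasure_stdExp : IsProbabilityMeasure stdExp := by
  constructor
  have h := stdExp_Ioi le_rfl
  rw [neg_zero, Real.exp_zero, ENNReal.ofReal_one] at h
  rw [← h]
  exact measure_congr (by
    filter_upwards [stdExp_ae_pos] with t ht
    exact propext ⟨fun _ => ht, fun _ => trivial⟩)

theorem integrable_log_stdExp : Integrable Real.log stdExp := by
  rw [stdExp, integrable_withDensity_iff (by fun_prop) (by simp)]
  have h1 := Real.GammaIntegral_convergent (s := 1 / 2) (by norm_num)
  have h2 := Real.GammaIntegral_convergent (s := 2) (by norm_num)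
  refine Integrable.mono' ((h1.const_mul 2).add h2) (by fun_prop) ?_
  filter_upwards [ae_restrict_mem measurableSet_Ioi] with t ht
  have ht0 : (0 : ℝ) < t := ht
  have he := Real.exp_pos (-t)
  rw [ENNReal.toReal_ofReal he.le, norm_mul, Real.norm_eq_abs, Real.norm_eq_abs, abs_of_pos he]
  have hpow : t ^ ((1 : ℝ) / 2 - 1) = (t⁻¹) ^ ((1 : ℝ) / 2) := by
    rw [Real.inv_rpow ht0.le, ← Real.rpow_neg ht0.le]; norm_num
  have hpow2 : t ^ ((2 : ℝ) - 1) = t := by norm_num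
  have hlow : Real.log t⁻¹ ≤ 2 * (t⁻¹) ^ ((1 : ℝ) / 2) := by
    have := Real.log_le_rpow_div (inv_pos.2 ht0).le (show (0 : ℝ) < 1 / 2 by norm_num)
    linarith
  have hup : Real.log t ≤ t := (Real.log_le_sub_one_of_pos ht0).trans (by linarith)
  have hb : |Real.log t| ≤ 2 * (t⁻¹) ^ ((1 : ℝ) / 2) + t := by
    rw [Real.log_inv] at hlow
    have : 0 ≤ (t⁻¹) ^ ((1 : ℝ) / 2) := by positivity
    rw [abs_le]; constructor <;> linarith
  simp only [Pi.add_apply]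
  rw [hpow, hpow2]
  nlinarith [mul_le_mul_of_nonneg_right hb he.le]

theorem integral_log_stdExp : ∫ t, Real.log t ∂stdExp = -constCE := by
  rw [stdExp, integral_withDensity_eq_integral_toReal_smul (by fun_prop) (by simp), constCE,
    neg_neg]
  refine integral_congr_ae (Eventually.of_forall fun t => ?_)
  simp [ENNReal.toReal_ofReal (Real.exp_pos _).le]

section Entropy

variable {d : ℕ} {f : EuclideanSpace ℝ (Fin d) → ℝ}

/-- The probability law on `ℝ^d` with density `f`. -/
noncomputable def densityLaw (f : EuclideanSpace ℝ (Fin d) → ℝ) :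
    Measure (EuclideanSpace ℝ (Fin d)) :=
  volume.withDensity (fun x => ENNReal.ofReal (f x))

/-- The limit `∫ e^{-e^u f(x)} f(x) dx` of the probability that the logarithm of the normalised
nearest neighbor volume exceeds `u`. -/
noncomputable def limitTail (f : EuclideanSpace ℝ (Fin d) → ℝ) (u : ℝ) : ℝ :=
  ∫ x, Real.exp (-(Real.exp u * f x)) ∂densityLaw f

theorem isProbabilityMeasure_densityLaw (hf : IsProbDensity f) :
    IsProbabilityMeasure (densityLaw f) :=
  ⟨by rw [densityLaw, withDensity_apply _ MeasurableSet.univ, Measure.restrict_univ,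
    hf.lintegral_eq_one]⟩

theorem densityLaw_ae_pos (hf : IsProbDensity f) : ∀ᵐ x ∂densityLaw f, 0 < f x := by
  rw [densityLaw, ae_withDensity_iff (by have := hf.measurable; fun_prop)]
  refine Eventually.of_forall fun x hx => ?_
  by_contra h
  exact hx (ENNReal.ofReal_of_nonpos (not_lt.1 h))

theorem integrable_log_densityLaw (hf : IsProbDensity f) (hH : HasFiniteEntropy f) :
    Integrable (fun x => Real.log (f x)) (densityLaw f) := by
  have := hf.measurable
  rw [densityLaw, integrable_withDensity_iff (by fun_prop) (by simp)]
  refine hH.congr (Eventually.of_forall fun x => ?_)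
  simp [ENNReal.toReal_ofReal (hf.nonneg x), mul_comm]

theorem integral_log_densityLaw (hf : IsProbDensity f) :
    ∫ x, Real.log (f x) ∂densityLaw f = -diffEntropy f := by
  have := hf.measurable
  rw [densityLaw, integral_withDensity_eq_integral_toReal_smul (by fun_prop) (by simp),
    diffEntropy, neg_neg]
  refine integral_congr_ae (Eventually.of_forall fun x => ?_)
  simp [ENNReal.toReal_ofReal (hf.nonneg x)]

/-- With `X` of density `f` and an independent standard exponential `E`, `limitTail f` is the tail
function of `log E - log f(X)`. -/
theorem tail_log_sub_log (hf : IsProbDensity f) (u : ℝ) :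
    ((densityLaw f).prod stdExp).real {p | u < Real.log p.2 - Real.log (f p.1)}
      = limitTail f u := by
  have := isProbabilityMeasure_densityLaw hf
  have hfm := hf.measurable
  have hm : MeasurableSet {p : EuclideanSpace ℝ (Fin d) × ℝ |
      u < Real.log p.2 - Real.log (f p.1)} := measurableSet_lt (by fun_prop) (by fun_prop)
  rw [measureReal_def, Measure.prod_apply hm, limitTail,
    integral_eq_lintegral_of_nonneg_ae (Eventually.of_forall fun x => (Real.exp_pos _).le)
      (by fun_prop)]
  congr 1
  refine lintegral_congr_ae ?_
  filter_upwards [densityLaw_ae_pos hf] with x hx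
  rw [← stdExp_Ioi (mul_pos (Real.exp_pos u) hx).le]
  refine measure_congr ?_
  filter_upwards [stdExp_ae_pos] with t ht
  refine propext ?_
  change u < Real.log t - Real.log (f x) ↔ Real.exp u * f x < t
  rw [← Real.log_div ht.ne' hx.ne', Real.lt_log_iff_exp_lt (div_pos ht hx), lt_div_iff₀ hx]

theorem integrable_log_sub_log (hf : IsProbDensity f) (hH : HasFiniteEntropy f) :
    Integrable (fun p : EuclideanSpace ℝ (Fin d) × ℝ => Real.log p.2 - Real.log (f p.1))
      ((densityLaw f).prod stdExp) := by
  have := isProbabilityMeasure_densityLaw hf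
  exact (integrable_log_stdExp.comp_snd _).sub ((integrable_log_densityLaw hf hH).comp_fst _)

theorem integrable_limitTail_sub (hf : IsProbDensity f) (hH : HasFiniteEntropy f) :
    Integrable (fun u : ℝ => limitTail f u - (if u < 0 then 1 else 0)) := by
  have := isProbabilityMeasure_densityLaw hf
  have hfm := hf.measurable
  simp_rw [← tail_log_sub_log hf]
  exact integrable_tail_sub (by fun_prop) (integrable_log_sub_log hf hH)

theorem integral_limitTail_sub (hf : IsProbDensity f) (hH : HasFiniteEntropy f) :
    ∫ u : ℝ, (limitTail f u - (if u < 0 then 1 else 0)) = diffEntropy f - constCE := by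
  have := isProbabilityMeasure_densityLaw hf
  have hfm := hf.measurable
  simp_rw [← tail_log_sub_log hf]
  rw [integral_tail_sub (by fun_prop) (integrable_log_sub_log hf hH),
    integral_sub (integrable_log_stdExp.comp_snd _) ((integrable_log_densityLaw hf hH).comp_fst _)]
  have h1 := integral_fun_snd (μ := densityLaw f) (ν := stdExp) Real.log
  have h2 := integral_fun_fst (μ := densityLaw f) (ν := stdExp) (fun x => Real.log (f x))
  rw [h1, h2, integral_log_stdExp, integral_log_densityLaw hf]
  simp
  ring

end Entropy

/-! ### Nearest neighbor distances of an independent sample -/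

section Geometry

variable {d : ℕ} {Ω : Type*} {X : ℕ → Ω → EuclideanSpace ℝ (Fin d)}

/-- The normalised volume `(n - 1) R_{n,i}^d v_d` of the nearest neighbor ball of the `i`-th point
among the first `n` terms of the sequence. -/
noncomputable def nnVolume (X : ℕ → Ω → EuclideanSpace ℝ (Fin d)) (n : ℕ) (i : Fin n) (ω : Ω) :
    ℝ :=
  ((n : ℝ) - 1) * nnDist (fun j : Fin n => X j ω) i (X i ω) ^ d * unitBallVolume d

/-- The radius of a ball of volume `s / (n - 1)` in `ℝ^d`, meaningful for `n ≥ 2` and `s ≥ 0`. -/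
noncomputable def nnRadius (d n : ℕ) (s : ℝ) : ℝ :=
  (s / (((n : ℝ) - 1) * unitBallVolume d)) ^ (1 / (d : ℝ))

theorem unitBallVolume_pos (d : ℕ) : 0 < unitBallVolume d :=
  ENNReal.toReal_pos (Metric.measure_ball_pos _ _ one_pos).ne' measure_ball_lt_top.ne

theorem nnRadius_nonneg {n : ℕ} (hn : 2 ≤ n) {s : ℝ} (hs : 0 ≤ s) : 0 ≤ nnRadius d n s := by
  have h1 : (2 : ℝ) ≤ n := by exact_mod_cast hn
  have := unitBallVolume_pos d
  exact Real.rpow_nonneg (div_nonneg hs (mul_nonneg (by linarith) this.le)) _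

theorem nnRadius_pow (hd : 1 ≤ d) {n : ℕ} (hn : 2 ≤ n) {s : ℝ} (hs : 0 ≤ s) :
    ((n : ℝ) - 1) * nnRadius d n s ^ d * unitBallVolume d = s := by
  have h1 : (2 : ℝ) ≤ n := by exact_mod_cast hn
  have := unitBallVolume_pos d
  rw [nnRadius, one_div, Real.rpow_inv_natCast_pow
    (div_nonneg hs (mul_nonneg (by linarith) this.le)) (by omega)]
  have : (n : ℝ) - 1 ≠ 0 := by linarith
  field_simp

theorem lt_nnDist_iff {n : ℕ} (hn : 2 ≤ n) (x : Fin n → EuclideanSpace ℝ (Fin d)) (i : Fin n)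
    (z : EuclideanSpace ℝ (Fin d)) (r : ℝ) :
    r < nnDist x i z ↔ ∀ j, j ≠ i → r < ‖z - x j‖ := by
  have : Nontrivial (Fin n) := Fin.nontrivial_iff_two_le.2 hn
  have : Nonempty {j : Fin n // j ≠ i} := by
    obtain ⟨j, hj⟩ := exists_ne i
    exact ⟨⟨j, hj⟩⟩
  constructor
  · intro h j hj
    exact h.trans_le (ciInf_le (Set.finite_range _).bddBelow (⟨j, hj⟩ : {j : Fin n // j ≠ i}))
  · intro h
    obtain ⟨j, hj⟩ := exists_eq_ciInf_of_finite (f := fun j : {j : Fin n // j ≠ i} => ‖z - x j‖)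
    rw [nnDist, ← hj]
    exact h j j.2

theorem nnDist_nonneg {n : ℕ} (x : Fin n → EuclideanSpace ℝ (Fin d)) (i : Fin n)
    (z : EuclideanSpace ℝ (Fin d)) : 0 ≤ nnDist x i z :=
  Real.iInf_nonneg fun _ => norm_nonneg _

theorem lt_nnVolume_iff (hd : 1 ≤ d) {n : ℕ} (hn : 2 ≤ n) (i : Fin n) (ω : Ω) {s : ℝ}
    (hs : 0 ≤ s) :
    s < nnVolume X n i ω ↔ ∀ k ∈ (Finset.range n).erase i,
      X k ω ∉ Metric.closedBall (X i ω) (nnRadius d n s) := by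
  have h1 : (2 : ℝ) ≤ n := by exact_mod_cast hn
  have hv := unitBallVolume_pos d
  have : s < nnVolume X n i ω ↔
      nnRadius d n s < nnDist (fun j : Fin n => X j ω) i (X i ω) := by
    conv_lhs => rw [← nnRadius_pow hd hn hs]
    rw [nnVolume, mul_lt_mul_iff_left₀ hv, mul_lt_mul_iff_right₀ (by linarith),
      pow_lt_pow_iff_left₀ (nnRadius_nonneg hn hs) (nnDist_nonneg _ _ _) (by omega)]
  rw [this, lt_nnDist_iff hn]
  simp only [Finset.mem_erase, Finset.mem_range, Metric.mem_closedBall, not_le, dist_comm _ (X i ω),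
    dist_eq_norm]
  constructor
  · rintro h k ⟨hk, hkn⟩
    exact h ⟨k, hkn⟩ (fun h => hk (by rw [← h]))
  · intro h j hj
    exact h j ⟨fun h => hj (Fin.ext h), j.2⟩

end Geometry

section Sample

variable {d : ℕ} {Ω : Type*} [MeasurableSpace Ω] {P : Measure Ω} [IsProbabilityMeasure P]
  {X : ℕ → Ω → EuclideanSpace ℝ (Fin d)} {μ : Measure (EuclideanSpace ℝ (Fin d))}

/-- Conditioning formula: if `Z` is independent of the sample points `X k`, `k ∈ S`, the
probability that all of them satisfy a relation with `Z` is a mixture of `|S|`-th powers. -/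
theorem measure_forall_mem_eq_lintegral_pow (hX : ∀ i, Measurable (X i)) (hindep : iIndepFun X P)
    (hlaw : ∀ i, P.map (X i) = μ) [SigmaFinite μ] {F : Type*} [MeasurableSpace F] {Z : Ω → F}
    (hZ : Measurable Z) (S : Finset ℕ)
    (hind : IndepFun Z (fun ω (k : S) => X k ω) P)
    {A : Set (F × EuclideanSpace ℝ (Fin d))} (hA : MeasurableSet A) :
    P {ω | ∀ k ∈ S, (Z ω, X k ω) ∈ A}
      = ∫⁻ z, (μ {y | (z, y) ∈ A}) ^ S.card ∂(P.map Z) := by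
  have hW : Measurable (fun ω (k : S) => X k ω) := by fun_prop
  have hWlaw : P.map (fun ω (k : S) => X k ω) = Measure.pi (fun _ : S => μ) := by
    have h := (iIndepFun_iff_map_fun_eq_pi_map (f := fun (k : S) => X k)
      (fun k => (hX k).aemeasurable)).1 (hindep.precomp Subtype.val_injective)
    rw [h]
    congr 1
    funext k
    exact hlaw k
  have hjoint := (indepFun_iff_map_prod_eq_prod_map_map hZ.aemeasurable hW.aemeasurable).1 hind
  set B : Set (F × (S → EuclideanSpace ℝ (Fin d))) := {p | ∀ k : S, (p.1, p.2 k) ∈ A} with hB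
  have hBm : MeasurableSet B := by
    rw [hB, Set.ofPred_forall]
    refine MeasurableSet.iInter fun k => ?_
    have hk : Measurable (fun p : F × (S → EuclideanSpace ℝ (Fin d)) => (p.1, p.2 k)) := by
      fun_prop
    exact hk hA
  have hpre : {ω | ∀ k ∈ S, (Z ω, X k ω) ∈ A}
      = (fun ω => (Z ω, fun (k : S) => X k ω)) ⁻¹' B := by
    ext ω; simp [hB]
  rw [hpre, ← Measure.map_apply (hZ.prodMk hW) hBm, hjoint, hWlaw, Measure.prod_apply hBm]
  refine lintegral_congr fun z => ?_
  have : Prod.mk z ⁻¹' B = Set.univ.pi (fun _ : S => {y | (z, y) ∈ A}) := by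
    ext y; simp [hB]
  rw [this, Measure.pi_pi]
  simp

theorem measurableSet_notMem_closedBall (r : ℝ) :
    MeasurableSet {p : EuclideanSpace ℝ (Fin d) × EuclideanSpace ℝ (Fin d) |
      p.2 ∉ Metric.closedBall p.1 r} := by
  simp only [Metric.mem_closedBall, not_le]
  exact measurableSet_lt measurable_const (by fun_prop)

/-- The probability that no other sample point lies within distance `r` of the `i`-th one. -/
theorem measure_isolated (hX : ∀ i, Measurable (X i)) (hindep : iIndepFun X P)
    (hlaw : ∀ i, P.map (X i) = μ) [SigmaFinite μ] {n i : ℕ} (hi : i < n) (r : ℝ) :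
    P {ω | ∀ k ∈ (Finset.range n).erase i, X k ω ∉ Metric.closedBall (X i ω) r}
      = ∫⁻ x, (μ (Metric.closedBall x r)ᶜ) ^ (n - 1) ∂μ := by
  have hind : IndepFun (X i) (fun ω (k : ((Finset.range n).erase i : Finset ℕ)) => X k ω) P := by
    have h := hindep.indepFun_finset {i} ((Finset.range n).erase i) (by simp) hX
    exact h.comp (φ := fun g : ({i} : Finset ℕ) → EuclideanSpace ℝ (Fin d) => g ⟨i, by simp⟩)
      (measurable_pi_apply _) measurable_id
  have h := measure_forall_mem_eq_lintegral_pow hX hindep hlaw (hX i)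
    ((Finset.range n).erase i) hind (measurableSet_notMem_closedBall r)
  rw [hlaw i, Finset.card_erase_of_mem (Finset.mem_range.2 hi), Finset.card_range] at h
  exact h

/-- Two sample points are both isolated at scale `r` with at most the probability that the `n - 2`
other points avoid the union of the two balls around them. -/
theorem measure_isolated_pair_le (hX : ∀ i, Measurable (X i)) (hindep : iIndepFun X P)
    (hlaw : ∀ i, P.map (X i) = μ) [SigmaFinite μ] {n i j : ℕ} (hi : i < n) (hj : j < n)
    (hij : i ≠ j) (r : ℝ) :
    P {ω | (∀ k ∈ (Finset.range n).erase i, X k ω ∉ Metric.closedBall (X i ω) r) ∧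
        ∀ k ∈ (Finset.range n).erase j, X k ω ∉ Metric.closedBall (X j ω) r}
      ≤ ∫⁻ z, (μ (Metric.closedBall z.1 r ∪ Metric.closedBall z.2 r)ᶜ) ^ (n - 2)
        ∂(μ.prod μ) := by
  set S : Finset ℕ := ((Finset.range n).erase i).erase j with hS
  have hind : IndepFun (fun ω => (X i ω, X j ω)) (fun ω (k : S) => X k ω) P := by
    have h := hindep.indepFun_finset {i, j} S (by simp [hS, Finset.disjoint_left]) hX
    exact h.comp (φ := fun g : ({i, j} : Finset ℕ) → EuclideanSpace ℝ (Fin d) =>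
      (g ⟨i, by simp⟩, g ⟨j, by simp⟩))
      ((measurable_pi_apply _).prodMk (measurable_pi_apply _)) measurable_id
  have hA : MeasurableSet {p : (EuclideanSpace ℝ (Fin d) × EuclideanSpace ℝ (Fin d)) ×
      EuclideanSpace ℝ (Fin d) |
      p.2 ∈ (Metric.closedBall p.1.1 r ∪ Metric.closedBall p.1.2 r)ᶜ} := by
    have h1 : Measurable (fun p : (EuclideanSpace ℝ (Fin d) × EuclideanSpace ℝ (Fin d)) ×
      EuclideanSpace ℝ (Fin d) => (p.1.1, p.2)) := by fun_prop
    have h2 : Measurable (fun p : (EuclideanSpace ℝ (Fin d) × EuclideanSpace ℝ (Fin d)) ×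
      EuclideanSpace ℝ (Fin d) => (p.1.2, p.2)) := by fun_prop
    have := (h1 (measurableSet_notMem_closedBall (d := d) r)).inter
      (h2 (measurableSet_notMem_closedBall (d := d) r))
    refine this.congr ?_
    ext p; simp
  have h := measure_forall_mem_eq_lintegral_pow hX hindep hlaw ((hX i).prodMk (hX j)) S hind hA
  have hcard : S.card = n - 2 := by
    rw [hS, Finset.card_erase_of_mem (by simp [hj, hij.symm]),
      Finset.card_erase_of_mem (by simp [hi]), Finset.card_range]
    omega
  rw [(indepFun_iff_map_prod_eq_prod_map_map (hX i).aemeasurable (hX j).aemeasurable).1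
    (hindep.indepFun hij), hlaw i, hlaw j, hcard] at h
  refine le_trans (measure_mono ?_) h.le
  rintro ω ⟨h1, h2⟩ k hk
  simp only [hS, Finset.mem_erase] at hk
  have := h1 k (by simp [hk])
  have := h2 k (by simp [hk])
  simp_all

theorem measurable_nnVolume (hX : ∀ i, Measurable (X i)) {n : ℕ} (i : Fin n) :
    Measurable (nnVolume X n i) := by
  unfold nnVolume nnDist
  refine ((Measurable.pow_const (Measurable.iInf fun j => ?_) d).const_mul _).mul_const _
  exact ((hX i).sub (hX j)).norm

theorem measure_lt_nnVolume (hd : 1 ≤ d) (hX : ∀ i, Measurable (X i)) (hindep : iIndepFun X P)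
    (hlaw : ∀ i, P.map (X i) = μ) [SigmaFinite μ] {n : ℕ} (hn : 2 ≤ n) (i : Fin n) {s : ℝ}
    (hs : 0 ≤ s) :
    P {ω | s < nnVolume X n i ω}
      = ∫⁻ x, (μ (Metric.closedBall x (nnRadius d n s))ᶜ) ^ (n - 1) ∂μ := by
  rw [← measure_isolated hX hindep hlaw i.2]
  simp_rw [lt_nnVolume_iff hd hn i _ hs]

/-- Coincidences in the sample are null events, so that the logarithms in the estimate are
genuine. -/
theorem ae_nnVolume_pos (hd : 1 ≤ d) (hX : ∀ i, Measurable (X i)) (hindep : iIndepFun X P)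
    (hlaw : ∀ i, P.map (X i) = μ) [IsProbabilityMeasure μ] [NullSingletonClass μ] {n : ℕ}
    (hn : 2 ≤ n) (i : Fin n) : ∀ᵐ ω ∂P, 0 < nnVolume X n i ω := by
  have hm : MeasurableSet {ω | 0 < nnVolume X n i ω} :=
    measurableSet_lt measurable_const (measurable_nnVolume hX i)
  have h := measure_lt_nnVolume hd hX hindep hlaw hn i le_rfl
  have h0 : nnRadius d n 0 = 0 := by
    rw [nnRadius, zero_div, Real.zero_rpow]
    have : (1 : ℝ) ≤ d := by exact_mod_cast hd
    positivity
  have h1 : ∀ x, μ (Metric.closedBall x (0 : ℝ))ᶜ = 1 := fun x => by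
    rw [Metric.closedBall_zero, prob_compl_eq_one_iff (measurableSet_singleton x),
      measure_singleton]
  simp only [h0, h1, one_pow, lintegral_const, measure_univ, mul_one] at h
  exact (mem_ae_iff_prob_eq_one hm).2 h

end Sample

/-! ### Uniform tail bounds for the nearest neighbor volumes -/

theorem one_le_pow_add_mul {a b : ℝ≥0∞} (hab : a + b = 1) (m : ℕ) : 1 ≤ a ^ m + m * b := by
  have ha : a ≤ 1 := hab ▸ le_self_add
  induction m with
  | zero => simp
  | succ m ih =>
    calc (1 : ℝ≥0∞) = a * 1 + b := by rw [mul_one, hab]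
      _ ≤ a * (a ^ m + m * b) + b := by gcongr
      _ = a ^ (m + 1) + (a * (m * b) + b) := by ring
      _ ≤ a ^ (m + 1) + (1 * (m * b) + b) := by gcongr
      _ = a ^ (m + 1) + ((m + 1 : ℕ) : ℝ≥0∞) * b := by push_cast; ring

theorem mul_mul_pow_le_one {a b : ℝ≥0∞} (hab : a + b = 1) (m : ℕ) : m * b * a ^ m ≤ 1 := by
  have ha : a ≤ 1 := hab ▸ le_self_add
  have hb : ∀ k : ℕ, (k : ℝ≥0∞) * b ≤ (1 + b) ^ k := by
    intro k
    induction k with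
    | zero => simp
    | succ k ih =>
      calc ((k + 1 : ℕ) : ℝ≥0∞) * b = k * b + 1 * b := by push_cast; ring
        _ ≤ (1 + b) ^ k + (1 + b) ^ k * b := by
          gcongr
          exact one_le_pow₀ le_self_add
        _ = (1 + b) ^ (k + 1) := by ring
  calc (m : ℝ≥0∞) * b * a ^ m ≤ (1 + b) ^ m * a ^ m := by gcongr; exact hb m
    _ = (a + a * b) ^ m := by rw [← mul_pow]; ring
    _ ≤ (a + 1 * b) ^ m := by gcongr
    _ = 1 := by rw [one_mul, hab, one_pow]

section Tail

variable {d : ℕ} {f : EuclideanSpace ℝ (Fin d) → ℝ}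

theorem measurableSet_dist_le (r : ℝ) :
    MeasurableSet {p : EuclideanSpace ℝ (Fin d) × EuclideanSpace ℝ (Fin d) | dist p.2 p.1 ≤ r} :=
  measurableSet_le (by fun_prop) measurable_const

theorem measurable_measure_closedBall (μ : Measure (EuclideanSpace ℝ (Fin d))) [SFinite μ]
    (r : ℝ) : Measurable (fun x => μ (Metric.closedBall x r)) :=
  measurable_measure_prodMk_left (measurableSet_dist_le r)

theorem lintegral_measure_closedBall_comm (μ ν : Measure (EuclideanSpace ℝ (Fin d))) [SFinite μ]
    [SFinite ν] (r : ℝ) :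
    ∫⁻ x, μ (Metric.closedBall x r) ∂ν = ∫⁻ y, ν (Metric.closedBall y r) ∂μ := by
  have h1 := Measure.prod_apply (μ := ν) (ν := μ) (measurableSet_dist_le (d := d) r)
  have h2 := Measure.prod_apply_symm (μ := ν) (ν := μ) (measurableSet_dist_le (d := d) r)
  have h3 : ∀ y : EuclideanSpace ℝ (Fin d), (fun x => (x, y)) ⁻¹'
      {p : EuclideanSpace ℝ (Fin d) × EuclideanSpace ℝ (Fin d) | dist p.2 p.1 ≤ r}
      = Metric.closedBall y r := by
    intro y; ext x; simp [dist_comm]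
  simp_rw [h3] at h2
  exact h1.symm.trans h2

theorem volume_closedBall_eq (x : EuclideanSpace ℝ (Fin d)) {r : ℝ} (hr : 0 ≤ r) :
    volume (Metric.closedBall x r) = ENNReal.ofReal (r ^ d * unitBallVolume d) := by
  rw [Measure.addHaar_closedBall _ _ hr, finrank_euclideanSpace_fin,
    ENNReal.ofReal_mul (pow_nonneg hr _), unitBallVolume,
    ENNReal.ofReal_toReal measure_ball_lt_top.ne]

theorem volume_closedBall_nnRadius (hd : 1 ≤ d) {n : ℕ} (hn : 2 ≤ n) {s : ℝ} (hs : 0 ≤ s)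
    (x : EuclideanSpace ℝ (Fin d)) :
    ((n - 1 : ℕ) : ℝ≥0∞) * volume (Metric.closedBall x (nnRadius d n s)) = ENNReal.ofReal s := by
  rw [volume_closedBall_eq x (nnRadius_nonneg hn hs), ← ENNReal.ofReal_natCast,
    ← ENNReal.ofReal_mul (Nat.cast_nonneg _), Nat.cast_sub (by omega), Nat.cast_one, ← mul_assoc,
    nnRadius_pow hd hn hs]

/-- The mass near `X` is at most `M r^d v_d` on average over the points where the density is at
most `M`: this is Fubini's theorem, and no maximal inequality is needed. -/
theorem lintegral_measure_closedBall_le (hf : IsProbDensity f) (M r : ℝ) :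
    ∫⁻ x in {x | f x ≤ M}, densityLaw f (Metric.closedBall x r) ∂densityLaw f
      ≤ ENNReal.ofReal M * volume (Metric.closedBall (0 : EuclideanSpace ℝ (Fin d)) r) := by
  have := isProbabilityMeasure_densityLaw hf
  have hfm := hf.measurable
  have hm : MeasurableSet {x | f x ≤ M} := measurableSet_le hfm measurable_const
  have hq := measurable_measure_closedBall (densityLaw f) r
  calc ∫⁻ x in {x | f x ≤ M}, densityLaw f (Metric.closedBall x r) ∂densityLaw f
      = ∫⁻ x in {x | f x ≤ M},
          ENNReal.ofReal (f x) * densityLaw f (Metric.closedBall x r) := by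
        have hr : (densityLaw f).restrict {x | f x ≤ M}
            = (volume.restrict {x | f x ≤ M}).withDensity (fun x => ENNReal.ofReal (f x)) :=
          restrict_withDensity hm _
        rw [hr, lintegral_withDensity_eq_lintegral_mul _ (by fun_prop) hq]
        rfl
    _ ≤ ∫⁻ x in {x | f x ≤ M}, ENNReal.ofReal M * densityLaw f (Metric.closedBall x r) := by
        refine setLIntegral_mono (by fun_prop) fun x hx => ?_
        gcongr
        exact hx
    _ ≤ ∫⁻ x, ENNReal.ofReal M * densityLaw f (Metric.closedBall x r) :=
        setLIntegral_le_lintegral _ _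
    _ = ENNReal.ofReal M * volume (Metric.closedBall (0 : EuclideanSpace ℝ (Fin d)) r) := by
        rw [lintegral_const_mul _ hq, lintegral_measure_closedBall_comm]
        congr 1
        have : ∀ y : EuclideanSpace ℝ (Fin d),
            volume (Metric.closedBall y r)
              = volume (Metric.closedBall (0 : EuclideanSpace ℝ (Fin d)) r) :=
          fun y => Measure.addHaar_closedBall_center _ y r
        simp_rw [this]
        simp

/-- Lower tail: `1 ≤ P(T > s) + P(f(X) > M) + M s` for the normalised nearest neighbor volume
`T`. -/
theorem one_le_isolated_add (hd : 1 ≤ d) (hf : IsProbDensity f) {n : ℕ} (hn : 2 ≤ n) {s : ℝ}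
    (hs : 0 ≤ s) {M : ℝ} (hM : 0 ≤ M) :
    1 ≤ (∫⁻ x, (densityLaw f (Metric.closedBall x (nnRadius d n s))ᶜ) ^ (n - 1) ∂densityLaw f)
      + (densityLaw f {x | M < f x} + ENNReal.ofReal (M * s)) := by
  have := isProbabilityMeasure_densityLaw hf
  have hfm := hf.measurable
  set r := nnRadius d n s
  have hm : MeasurableSet {x | M < f x} := measurableSet_lt measurable_const hfm
  have hm' : MeasurableSet {x | f x ≤ M} := measurableSet_le hfm measurable_const
  have hq := measurable_measure_closedBall (densityLaw f) r
  have hsum : ∀ x, densityLaw f (Metric.closedBall x r)ᶜ + densityLaw f (Metric.closedBall x r)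
      = 1 := fun x => by
    rw [add_comm, measure_add_measure_compl Metric.isClosed_closedBall.measurableSet, measure_univ]
  have hpow : Measurable (fun x => (densityLaw f (Metric.closedBall x r)ᶜ) ^ (n - 1)) := by
    have : ∀ x, densityLaw f (Metric.closedBall x r)ᶜ
        = 1 - densityLaw f (Metric.closedBall x r) := fun x =>
      prob_compl_eq_one_sub Metric.isClosed_closedBall.measurableSet
    simp_rw [this]
    exact (measurable_const.sub hq).pow_const _
  calc (1 : ℝ≥0∞) = ∫⁻ _, 1 ∂densityLaw f := by simp
    _ ≤ ∫⁻ x, ((densityLaw f (Metric.closedBall x r)ᶜ) ^ (n - 1)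
          + ({x | M < f x}.indicator 1 x + {x | f x ≤ M}.indicator
              (fun x => ((n - 1 : ℕ) : ℝ≥0∞) * densityLaw f (Metric.closedBall x r)) x))
          ∂densityLaw f := by
        refine lintegral_mono fun x => ?_
        by_cases hx : M < f x
        · rw [Set.indicator_of_mem (show x ∈ {x | M < f x} from hx), Pi.one_apply]
          exact le_add_self.trans' le_self_add
        · rw [Set.indicator_of_mem (show x ∈ {x | f x ≤ M} from not_lt.1 hx)]
          refine (one_le_pow_add_mul (hsum x) (n - 1)).trans ?_
          gcongr
          exact le_add_self
    _ = (∫⁻ x, (densityLaw f (Metric.closedBall x r)ᶜ) ^ (n - 1) ∂densityLaw f)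
          + (densityLaw f {x | M < f x} + ((n - 1 : ℕ) : ℝ≥0∞) *
            ∫⁻ x in {x | f x ≤ M}, densityLaw f (Metric.closedBall x r) ∂densityLaw f) := by
        rw [lintegral_add_left hpow, lintegral_add_left (measurable_one.indicator hm),
          lintegral_indicator_one hm, lintegral_indicator hm', lintegral_const_mul _ hq]
    _ ≤ _ := by
        gcongr
        calc ((n - 1 : ℕ) : ℝ≥0∞) *
              ∫⁻ x in {x | f x ≤ M}, densityLaw f (Metric.closedBall x r) ∂densityLaw f
            ≤ ((n - 1 : ℕ) : ℝ≥0∞) * (ENNReal.ofReal M *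
              volume (Metric.closedBall (0 : EuclideanSpace ℝ (Fin d)) r)) := by
              gcongr
              exact lintegral_measure_closedBall_le hf M r
          _ = ENNReal.ofReal M * (((n - 1 : ℕ) : ℝ≥0∞) *
              volume (Metric.closedBall (0 : EuclideanSpace ℝ (Fin d)) r)) := by ring
          _ = ENNReal.ofReal (M * s) := by
              rw [volume_closedBall_nnRadius hd hn hs, ENNReal.ofReal_mul hM]

/-- Averaging form of the bound on covering numbers: integrating the inverse mass of `B(x, r)` over
a ball of radius `ρ` gives at most the ratio of the volumes of balls of radii `ρ + r / 2` and
`r / 2`. The mass of `B(x, r)` is compared with that of `B(y, r / 2)` for `y ∈ B(x, r / 2)`, and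
`y` is integrated out. -/
theorem lintegral_inv_measure_closedBall_mul_le (μ : Measure (EuclideanSpace ℝ (Fin d)))
    [IsFiniteMeasure μ] (ρ r : ℝ) :
    (∫⁻ x in Metric.closedBall 0 ρ, (μ (Metric.closedBall x r))⁻¹ ∂μ)
        * volume (Metric.closedBall (0 : EuclideanSpace ℝ (Fin d)) (r / 2))
      ≤ volume (Metric.closedBall (0 : EuclideanSpace ℝ (Fin d)) (ρ + r / 2)) := by
  have hq : Measurable (fun x => (μ (Metric.closedBall x r))⁻¹) :=
    (measurable_measure_closedBall μ r).inv
  set S : Set (EuclideanSpace ℝ (Fin d) × EuclideanSpace ℝ (Fin d)) :=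
    {p | dist p.2 p.1 ≤ r / 2} with hS
  have hSm : MeasurableSet S := measurableSet_dist_le _
  set ν := μ.restrict (Metric.closedBall 0 ρ) with hν
  have hinner : ∀ y, ∫⁻ x, (μ (Metric.closedBall x r))⁻¹ * S.indicator 1 (x, y) ∂ν
      ≤ (Metric.closedBall (0 : EuclideanSpace ℝ (Fin d)) (ρ + r / 2)).indicator 1 y := by
    intro y
    by_cases hy : y ∈ Metric.closedBall (0 : EuclideanSpace ℝ (Fin d)) (ρ + r / 2)
    · rw [Set.indicator_of_mem hy, Pi.one_apply]
      calc ∫⁻ x, (μ (Metric.closedBall x r))⁻¹ * S.indicator 1 (x, y) ∂ν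
          ≤ ∫⁻ x, (Metric.closedBall y (r / 2)).indicator
              (fun _ => (μ (Metric.closedBall y (r / 2)))⁻¹) x ∂ν := by
            refine lintegral_mono fun x => ?_
            by_cases hx : x ∈ Metric.closedBall y (r / 2)
            · rw [Set.indicator_of_mem hx]
              have h1 : S.indicator (1 : EuclideanSpace ℝ (Fin d) × EuclideanSpace ℝ (Fin d) → ℝ≥0∞)
                  (x, y) ≤ 1 := Set.indicator_apply_le' (fun _ => le_rfl) fun _ => zero_le
              refine (mul_le_of_le_one_right' h1).trans ?_
              refine ENNReal.inv_le_inv.2 (measure_mono ?_)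
              refine Metric.closedBall_subset_closedBall' ?_
              rw [dist_comm]
              have := Metric.mem_closedBall.1 hx
              linarith
            · have : (x, y) ∉ S := fun h => hx (by
                simpa [hS, dist_comm] using h)
              simp [this]
        _ = (μ (Metric.closedBall y (r / 2)))⁻¹ * ν (Metric.closedBall y (r / 2)) := by
            rw [lintegral_indicator Metric.isClosed_closedBall.measurableSet, setLIntegral_const]
        _ ≤ (μ (Metric.closedBall y (r / 2)))⁻¹ * μ (Metric.closedBall y (r / 2)) := by
            gcongr
            exact Measure.restrict_le_self
        _ ≤ 1 := ENNReal.inv_mul_le_one _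
    · rw [Set.indicator_of_notMem hy, nonpos_iff_eq_zero]
      refine (lintegral_congr_ae ?_).trans lintegral_zero
      filter_upwards [ae_restrict_mem Metric.isClosed_closedBall.measurableSet] with x hx
      have : (x, y) ∉ S := fun h => hy (by
        have h1 : dist y x ≤ r / 2 := h
        have h2 := Metric.mem_closedBall.1 hx
        exact Metric.mem_closedBall.2 (by linarith [dist_triangle y x 0]))
      simp [this]
  calc (∫⁻ x, (μ (Metric.closedBall x r))⁻¹ ∂ν)
        * volume (Metric.closedBall (0 : EuclideanSpace ℝ (Fin d)) (r / 2))
      = ∫⁻ x, ∫⁻ y, (μ (Metric.closedBall x r))⁻¹ * S.indicator 1 (x, y) ∂volume ∂ν := by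
        rw [← lintegral_mul_const _ hq]
        refine lintegral_congr fun x => ?_
        have hsec : (fun y => S.indicator
            (1 : EuclideanSpace ℝ (Fin d) × EuclideanSpace ℝ (Fin d) → ℝ≥0∞) (x, y))
            = (Metric.closedBall x (r / 2)).indicator 1 := by
          funext y
          exact Set.indicator_eq_indicator (by simp [hS]) rfl
        rw [lintegral_const_mul _ (by
          rw [hsec]; exact measurable_one.indicator Metric.isClosed_closedBall.measurableSet),
          hsec, lintegral_indicator_one Metric.isClosed_closedBall.measurableSet,
          Measure.addHaar_closedBall_center volume x]
    _ = ∫⁻ y, ∫⁻ x, (μ (Metric.closedBall x r))⁻¹ * S.indicator 1 (x, y) ∂ν := by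
        refine lintegral_lintegral_swap (Measurable.aemeasurable ?_)
        exact (hq.comp measurable_fst).mul (measurable_one.indicator hSm)
    _ ≤ ∫⁻ y, (Metric.closedBall (0 : EuclideanSpace ℝ (Fin d)) (ρ + r / 2)).indicator 1 y :=
        lintegral_mono hinner
    _ = _ := lintegral_indicator_one Metric.isClosed_closedBall.measurableSet

/-- Upper tail: `P(T > s) ≤ 2 P(‖X‖ > ρ / 2) + 3^d / √s` for the normalised nearest neighbor volume
`T`, where the ball of radius `ρ` has volume `√s`. The bound does not depend on the sample size. -/
theorem isolated_le (hd : 1 ≤ d) (μ : Measure (EuclideanSpace ℝ (Fin d)))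
    [IsProbabilityMeasure μ] {n : ℕ} (hn : 2 ≤ n) {s : ℝ} (hs : 0 < s) :
    ∫⁻ x, (μ (Metric.closedBall x (nnRadius d n s))ᶜ) ^ (n - 1) ∂μ
      ≤ 2 * μ {x | nnRadius d 2 (√s) / 2 < ‖x‖} + ENNReal.ofReal (3 ^ d / √s) := by
  set r := nnRadius d n s with hr
  set ρ := nnRadius d 2 (√s) with hρ
  have hr0 : 0 ≤ r := nnRadius_nonneg hn hs.le
  have hρ0 : 0 ≤ ρ := nnRadius_nonneg le_rfl (Real.sqrt_nonneg _)
  have hrs : ((n : ℝ) - 1) * r ^ d * unitBallVolume d = s := nnRadius_pow hd hn hs.le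
  have hρs : ρ ^ d * unitBallVolume d = √s := by
    have := nnRadius_pow (d := d) hd le_rfl (Real.sqrt_nonneg s)
    norm_num at this
    exact this
  have hm0 : n - 1 ≠ 0 := by omega
  have hn1 : (2 : ℝ) ≤ n := by exact_mod_cast hn
  have hrpos : 0 < r := by
    refine lt_of_le_of_ne hr0 fun h => hs.ne ?_
    rw [← hrs, ← h, zero_pow (by omega)]
    ring
  have hle1 : ∀ x, (μ (Metric.closedBall x r)ᶜ) ^ (n - 1) ≤ 1 := fun x =>
    pow_le_one₀ zero_le prob_le_one
  have hlt : ∀ a : ℝ, MeasurableSet {x : EuclideanSpace ℝ (Fin d) | a < ‖x‖} := fun a =>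
    measurableSet_lt measurable_const measurable_norm
  rcases le_total ρ r with hcase | hcase
  · -- If `ρ ≤ r`, the ball around a point of `B(0, ρ / 2)` contains `B(0, ρ / 2)`.
    calc ∫⁻ x, (μ (Metric.closedBall x r)ᶜ) ^ (n - 1) ∂μ
        ≤ ∫⁻ x, ({x | ρ / 2 < ‖x‖}.indicator 1 x + μ {x | ρ / 2 < ‖x‖}) ∂μ := by
          refine lintegral_mono fun x => ?_
          by_cases hx : ρ / 2 < ‖x‖
          · rw [Set.indicator_of_mem (show x ∈ {x | ρ / 2 < ‖x‖} from hx)]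
            exact (hle1 x).trans le_self_add
          · refine le_add_self.trans' ?_
            refine (pow_le_of_le_one zero_le prob_le_one hm0).trans (measure_mono ?_)
            intro y hy
            by_contra hy'
            refine hy (Metric.mem_closedBall.2 ?_)
            have h1 : ‖y‖ ≤ ρ / 2 := not_lt.1 hy'
            rw [dist_eq_norm]
            linarith [norm_sub_le y x, not_lt.1 hx]
      _ = 2 * μ {x | ρ / 2 < ‖x‖} := by
          rw [lintegral_add_left (measurable_one.indicator (hlt _)),
            lintegral_indicator_one (hlt _)]
          simp [two_mul]
      _ ≤ _ := le_self_add
  · -- If `r ≤ ρ`, use `(1 - q)^m ≤ 1 / (m q)` inside `B(0, ρ)` and the averaged covering bound.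
    have hB : MeasurableSet (Metric.closedBall (0 : EuclideanSpace ℝ (Fin d)) ρ) :=
      Metric.isClosed_closedBall.measurableSet
    have hq : Measurable (fun x => (μ (Metric.closedBall x r))⁻¹) :=
      (measurable_measure_closedBall μ r).inv
    have hm0' : ((n - 1 : ℕ) : ℝ≥0∞) ≠ 0 := by exact_mod_cast hm0
    have hmt : ((n - 1 : ℕ) : ℝ≥0∞) ≠ ⊤ := ENNReal.natCast_ne_top _
    have hinv : ∀ x, (μ (Metric.closedBall x r)ᶜ) ^ (n - 1)
        ≤ ((n - 1 : ℕ) : ℝ≥0∞)⁻¹ * (μ (Metric.closedBall x r))⁻¹ := fun x => by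
      rw [← ENNReal.mul_inv (Or.inl hm0') (Or.inl hmt), ENNReal.le_inv_iff_mul_le, mul_comm]
      refine mul_mul_pow_le_one ?_ _
      rw [add_comm, measure_add_measure_compl Metric.isClosed_closedBall.measurableSet,
        measure_univ]
    have hcov : ((n - 1 : ℕ) : ℝ≥0∞)⁻¹ *
        ∫⁻ x in Metric.closedBall 0 ρ, (μ (Metric.closedBall x r))⁻¹ ∂μ
        ≤ ENNReal.ofReal (3 ^ d / √s) := by
      have h := lintegral_inv_measure_closedBall_mul_le μ ρ r
      rw [volume_closedBall_eq _ (by positivity), volume_closedBall_eq _ (by positivity)] at h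
      have hv := unitBallVolume_pos d
      have h' := (ENNReal.le_div_iff_mul_le (Or.inl (by
        rw [Ne, ENNReal.ofReal_eq_zero, not_le]; positivity)) (Or.inl ENNReal.ofReal_ne_top)).2 h
      rw [← ENNReal.ofReal_div_of_pos (by positivity)] at h'
      have hc : ((n - 1 : ℕ) : ℝ≥0∞)⁻¹ = ENNReal.ofReal (((n : ℝ) - 1)⁻¹) := by
        rw [ENNReal.ofReal_inv_of_pos (by linarith), ← ENNReal.ofReal_natCast,
          Nat.cast_sub (by omega), Nat.cast_one]
      rw [hc]
      refine (mul_le_mul_right h' _).trans ?_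
      rw [← ENNReal.ofReal_mul (inv_nonneg.2 (by linarith))]
      refine ENNReal.ofReal_le_ofReal ?_
      have hsq : √s * √s = s := Real.mul_self_sqrt hs.le
      have hsp : 0 < √s := Real.sqrt_pos.2 hs
      have hnum : (ρ + r / 2) ^ d ≤ (3 * ρ * (1 / 2)) ^ d := by
        gcongr
        linarith
      have hn1' : 0 < (n : ℝ) - 1 := by linarith
      rw [mul_pow, mul_pow] at hnum
      rw [div_eq_mul_one_div r 2, mul_pow r, inv_mul_eq_div, div_div,
        div_le_div_iff₀ (by positivity) hsp]
      rw [← div_eq_mul_one_div r 2]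
      have key : 3 ^ d * ((r ^ d * (1 / 2) ^ d * unitBallVolume d) * ((n : ℝ) - 1))
          = (3 ^ d * ρ ^ d * (1 / 2) ^ d) * unitBallVolume d * √s := by
        calc _ = 3 ^ d * (1 / 2) ^ d * (((n : ℝ) - 1) * r ^ d * unitBallVolume d) := by ring
          _ = 3 ^ d * (1 / 2) ^ d * (ρ ^ d * unitBallVolume d) * √s := by
              rw [hrs, hρs, mul_assoc _ (√s), hsq]
          _ = _ := by ring
      rw [key]
      gcongr
    calc ∫⁻ x, (μ (Metric.closedBall x r)ᶜ) ^ (n - 1) ∂μ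
        ≤ ∫⁻ x, ({x | ρ / 2 < ‖x‖}.indicator 1 x +
            (Metric.closedBall (0 : EuclideanSpace ℝ (Fin d)) ρ).indicator
              (fun x => ((n - 1 : ℕ) : ℝ≥0∞)⁻¹ * (μ (Metric.closedBall x r))⁻¹) x) ∂μ := by
          refine lintegral_mono fun x => ?_
          by_cases hx : ρ / 2 < ‖x‖
          · rw [Set.indicator_of_mem (show x ∈ {x | ρ / 2 < ‖x‖} from hx)]
            exact (hle1 x).trans le_self_add
          · rw [Set.indicator_of_mem (s := Metric.closedBall 0 ρ)
              (mem_closedBall_zero_iff.2 (by linarith [not_lt.1 hx]))]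
            exact (hinv x).trans le_add_self
      _ = μ {x | ρ / 2 < ‖x‖} + ((n - 1 : ℕ) : ℝ≥0∞)⁻¹ *
            ∫⁻ x in Metric.closedBall 0 ρ, (μ (Metric.closedBall x r))⁻¹ ∂μ := by
          rw [lintegral_add_left (measurable_one.indicator (hlt _)),
            lintegral_indicator_one (hlt _), lintegral_indicator hB, lintegral_const_mul _ hq]
      _ ≤ 2 * μ {x | ρ / 2 < ‖x‖} + ENNReal.ofReal (3 ^ d / √s) := by
          refine add_le_add ?_ hcov
          rw [two_mul]
          exact le_self_add

end Tail

/-! ### Integrable majorants -/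

section Majorant

variable {d : ℕ} {f : EuclideanSpace ℝ (Fin d) → ℝ}

/-- Majorant of `P(T ≤ e^u)` for `u < 0`, where `T` is a normalised nearest neighbor volume. The
density is cut at the level `e^{-u/2}`, which balances the two terms of `one_le_isolated_add`. -/
noncomputable def lowerMajorant (f : EuclideanSpace ℝ (Fin d) → ℝ) (u : ℝ) : ℝ≥0∞ :=
  densityLaw f {x | Real.exp (-u / 2) < f x} + ENNReal.ofReal (Real.exp (u / 2))

/-- Majorant of `P(T > e^u)` for `u ≥ 0`, where `T` is a normalised nearest neighbor volume. -/
noncomputable def upperMajorant (μ : Measure (EuclideanSpace ℝ (Fin d))) (u : ℝ) : ℝ≥0∞ :=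
  2 * μ {x | nnRadius d 2 (Real.exp (u / 2)) / 2 < ‖x‖}
    + ENNReal.ofReal (3 ^ d * Real.exp (-u / 2))

theorem lintegral_tail_eq {α : Type*} [MeasurableSpace α] (ν : Measure α) {Y : α → ℝ}
    (hY : Measurable Y) :
    ∫⁻ t in Set.Ioi (0 : ℝ), ν {ω | t < Y ω} = ∫⁻ ω, ENNReal.ofReal (Y ω) ∂ν := by
  have h := lintegral_eq_lintegral_meas_lt (f := fun ω => max (Y ω) 0) ν
    (Eventually.of_forall fun ω => le_max_right _ _) (hY.max measurable_const).aemeasurable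
  have h1 : ∀ ω, ENNReal.ofReal (max (Y ω) 0) = ENNReal.ofReal (Y ω) := fun ω => by simp
  simp_rw [h1] at h
  rw [h]
  refine setLIntegral_congr_fun measurableSet_Ioi fun t (ht : 0 < t) => ?_
  congr 1
  ext ω
  simp [ht.not_gt]

theorem setLIntegral_Iio_eq_Ioi (g : ℝ → ℝ≥0∞) :
    ∫⁻ u in Set.Iio (0 : ℝ), g u = ∫⁻ t in Set.Ioi (0 : ℝ), g (-t) := by
  have h := (Measure.measurePreserving_neg (volume : Measure ℝ)).setLIntegral_comp_preimage_emb
    (MeasurableEquiv.neg ℝ).measurableEmbedding g (Set.Iio 0)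
  rw [← h]
  simp

theorem lintegral_lowerMajorant_lt_top (hf : IsProbDensity f) (hH : HasFiniteEntropy f) :
    ∫⁻ u in Set.Iio (0 : ℝ), lowerMajorant f u < ⊤ := by
  have hfm := hf.measurable
  rw [setLIntegral_Iio_eq_Ioi]
  unfold lowerMajorant
  rw [lintegral_add_right _ (by fun_prop)]
  refine ENNReal.add_lt_top.2 ⟨?_, ?_⟩
  · calc ∫⁻ t in Set.Ioi (0 : ℝ), densityLaw f {x | Real.exp (- -t / 2) < f x}
        ≤ ∫⁻ t in Set.Ioi (0 : ℝ), densityLaw f {x | t < 2 * Real.log (f x)} := by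
          refine lintegral_mono fun t => measure_mono fun x (hx : Real.exp (- -t / 2) < f x) => ?_
          have := (Real.lt_log_iff_exp_lt ((Real.exp_pos _).trans hx)).2 hx
          rw [neg_neg] at this
          exact show t < 2 * Real.log (f x) by linarith
      _ = ∫⁻ x, ENNReal.ofReal (2 * Real.log (f x)) ∂densityLaw f :=
          lintegral_tail_eq _ (by fun_prop)
      _ < ⊤ := ((integrable_log_densityLaw hf hH).const_mul 2).lintegral_lt_top
  · have h : IntegrableOn (fun t : ℝ => Real.exp (-(1 / 2) * t)) (Set.Ioi 0) :=
      exp_neg_integrableOn_Ioi 0 (by norm_num)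
    refine lt_of_eq_of_lt (lintegral_congr fun t => ?_) h.lintegral_lt_top
    congr 2
    ring

theorem lintegral_upperMajorant_lt_top (hd : 1 ≤ d) (μ : Measure (EuclideanSpace ℝ (Fin d)))
    [IsProbabilityMeasure μ] (hlog : ∫⁻ x, ENNReal.ofReal (max (Real.log ‖x‖) 0) ∂μ < ⊤) :
    ∫⁻ u in Set.Ioi (0 : ℝ), upperMajorant μ u < ⊤ := by
  have hv := unitBallVolume_pos d
  unfold upperMajorant
  rw [lintegral_add_right _ (by fun_prop)]
  refine ENNReal.add_lt_top.2 ⟨?_, ?_⟩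
  · rw [lintegral_const_mul' _ _ (by simp)]
    refine ENNReal.mul_lt_top (by simp) ?_
    set c : ℝ := 2 * (Real.log (unitBallVolume d) + d * Real.log 2) with hc
    calc ∫⁻ u in Set.Ioi (0 : ℝ), μ {x | nnRadius d 2 (Real.exp (u / 2)) / 2 < ‖x‖}
        ≤ ∫⁻ u in Set.Ioi (0 : ℝ), μ {x | u < c + 2 * d * Real.log ‖x‖} := by
          refine lintegral_mono fun u => measure_mono fun x hx => ?_
          have hx' : nnRadius d 2 (Real.exp (u / 2)) / 2 < ‖x‖ := hx
          have hr0 := nnRadius_nonneg (d := d) le_rfl (Real.exp_pos (u / 2)).le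
          have hr := nnRadius_pow (d := d) hd le_rfl (Real.exp_pos (u / 2)).le
          norm_num at hr
          have hxpos : 0 < ‖x‖ := lt_of_le_of_lt (by positivity) hx'
          have h1 : Real.exp (u / 2) < (2 * ‖x‖) ^ d * unitBallVolume d := by
            rw [← hr]
            refine mul_lt_mul_of_pos_right (pow_lt_pow_left₀ (by linarith) hr0 (by omega)) hv
          have h2 := (Real.lt_log_iff_exp_lt (by positivity)).2 h1
          rw [Real.log_mul (by positivity) hv.ne', Real.log_pow,
            Real.log_mul (by norm_num) hxpos.ne'] at h2
          change u < c + 2 * d * Real.log ‖x‖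
          rw [hc]
          linarith
      _ = ∫⁻ x, ENNReal.ofReal (c + 2 * d * Real.log ‖x‖) ∂μ :=
          lintegral_tail_eq _ (by fun_prop)
      _ ≤ ∫⁻ x, (ENNReal.ofReal c
            + ENNReal.ofReal (2 * d) * ENNReal.ofReal (max (Real.log ‖x‖) 0)) ∂μ := by
          refine lintegral_mono fun x => ?_
          rw [← ENNReal.ofReal_mul (by positivity)]
          refine (ENNReal.ofReal_le_ofReal ?_).trans ENNReal.ofReal_add_le
          gcongr
          exact le_max_left _ _
      _ < ⊤ := by
          rw [lintegral_add_left measurable_const, lintegral_const,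
            lintegral_const_mul' _ _ ENNReal.ofReal_ne_top]
          refine ENNReal.add_lt_top.2 ⟨?_, ENNReal.mul_lt_top ENNReal.ofReal_lt_top hlog⟩
          simp
  · have h : IntegrableOn (fun t : ℝ => 3 ^ d * Real.exp (-(1 / 2) * t)) (Set.Ioi 0) :=
      (exp_neg_integrableOn_Ioi 0 (by norm_num)).const_mul _
    refine lt_of_eq_of_lt (lintegral_congr fun t => ?_) h.lintegral_lt_top
    congr 3
    ring

end Majorant

section SampleTail

variable {d : ℕ} {f : EuclideanSpace ℝ (Fin d) → ℝ} {Ω : Type*} [MeasurableSpace Ω]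
  {P : Measure Ω} [IsProbabilityMeasure P] {X : ℕ → Ω → EuclideanSpace ℝ (Fin d)}

theorem nullSingletonClass_densityLaw (hd : 1 ≤ d) : NullSingletonClass (densityLaw f) := by
  have : Nontrivial (EuclideanSpace ℝ (Fin d)) := by
    have : Nonempty (Fin d) := ⟨⟨0, hd⟩⟩
    infer_instance
  exact ⟨fun x => withDensity_absolutelyContinuous _ _ (measure_singleton x)⟩

theorem measure_nnVolume_le_le (hd : 1 ≤ d) (hf : IsProbDensity f) (hX : ∀ i, Measurable (X i))
    (hindep : iIndepFun X P) (hlaw : ∀ i, P.map (X i) = densityLaw f) {n : ℕ} (hn : 2 ≤ n)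
    (i : Fin n) (u : ℝ) :
    P {ω | nnVolume X n i ω ≤ Real.exp u} ≤ lowerMajorant f u := by
  have := isProbabilityMeasure_densityLaw hf
  have h := one_le_isolated_add hd hf hn (Real.exp_pos u).le (Real.exp_pos (-u / 2)).le
  rw [← measure_lt_nnVolume hd hX hindep hlaw hn i (Real.exp_pos u).le, ← Real.exp_add] at h
  have hm : MeasurableSet {ω | Real.exp u < nnVolume X n i ω} :=
    measurableSet_lt measurable_const (measurable_nnVolume hX i)
  have hc : {ω | nnVolume X n i ω ≤ Real.exp u} = {ω | Real.exp u < nnVolume X n i ω}ᶜ := by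
    ext ω; simp
  rw [hc, prob_compl_eq_one_sub hm, tsub_le_iff_left, lowerMajorant]
  have he : -u / 2 + u = u / 2 := by ring
  rwa [he] at h

theorem measure_lt_nnVolume_le (hd : 1 ≤ d) {μ : Measure (EuclideanSpace ℝ (Fin d))}
    [IsProbabilityMeasure μ] (hX : ∀ i, Measurable (X i))
    (hindep : iIndepFun X P) (hlaw : ∀ i, P.map (X i) = μ) {n : ℕ} (hn : 2 ≤ n)
    (i : Fin n) (u : ℝ) :
    P {ω | Real.exp u < nnVolume X n i ω} ≤ upperMajorant μ u := by
  rw [measure_lt_nnVolume hd hX hindep hlaw hn i (Real.exp_pos u).le]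
  refine (isolated_le hd _ hn (Real.exp_pos u)).trans ?_
  rw [← Real.exp_half, upperMajorant, neg_div, Real.exp_neg, ← div_eq_mul_inv (3 ^ d : ℝ)]

end SampleTail

/-! ### Limits of isolation probabilities -/

theorem tendsto_one_sub_pow_succ {a : ℕ → ℝ} {t : ℝ}
    (h : Tendsto (fun m : ℕ => ((m : ℝ) + 1) * a m) atTop (𝓝 t)) :
    Tendsto (fun m : ℕ => (1 - a m) ^ (m + 1)) atTop (𝓝 (Real.exp (-t))) := by
  have h1 : Tendsto (fun k : ℕ => (k : ℝ) * (-a (k - 1))) atTop (𝓝 (-t)) := by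
    rw [← tendsto_add_atTop_iff_nat 1]
    refine h.neg.congr fun m => ?_
    simp
  have h2 := (tendsto_add_atTop_iff_nat 1).2 (Real.tendsto_one_add_pow_exp_of_tendsto h1)
  refine h2.congr fun m => ?_
  simp [sub_eq_add_neg]

theorem tendsto_one_sub_pow {a : ℕ → ℝ} {t : ℝ}
    (h : Tendsto (fun m : ℕ => ((m : ℝ) + 1) * a m) atTop (𝓝 t)) :
    Tendsto (fun m : ℕ => (1 - a m) ^ m) atTop (𝓝 (Real.exp (-t))) := by
  have h0 : Tendsto a atTop (𝓝 0) := by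
    have := h.mul (tendsto_one_div_add_atTop_nhds_zero_nat (𝕜 := ℝ))
    rw [mul_zero] at this
    refine this.congr fun m => ?_
    have : (m : ℝ) + 1 ≠ 0 := by positivity
    field_simp
  have h1 : Tendsto (fun m : ℕ => (m : ℝ) * (-a m)) atTop (𝓝 (-t)) := by
    have := (h.sub h0).neg
    rw [sub_zero] at this
    exact this.congr fun m => by ring
  refine (Real.tendsto_one_add_pow_exp_of_tendsto h1).congr fun m => ?_
  simp [sub_eq_add_neg]

section Limit

variable {d : ℕ} {f : EuclideanSpace ℝ (Fin d) → ℝ}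

theorem tendsto_nnRadius (hd : 1 ≤ d) (s : ℝ) :
    Tendsto (fun m : ℕ => nnRadius d (m + 2) s) atTop (𝓝 0) := by
  have hd' : (0 : ℝ) < 1 / d := by
    have : (1 : ℝ) ≤ d := by exact_mod_cast hd
    positivity
  have h : Tendsto (fun m : ℕ => s / unitBallVolume d * (1 / ((m : ℝ) + 1))) atTop (𝓝 0) := by
    simpa using (tendsto_one_div_add_atTop_nhds_zero_nat (𝕜 := ℝ)).const_mul
      (s / unitBallVolume d)
  have h2 := h.rpow_const (p := 1 / (d : ℝ)) (Or.inr hd'.le)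
  rw [Real.zero_rpow hd'.ne'] at h2
  refine h2.congr fun m => ?_
  have hv := (unitBallVolume_pos d).ne'
  have : (m : ℝ) + 1 ≠ 0 := by positivity
  rw [nnRadius]
  congr 1
  push_cast
  rw [show (m : ℝ) + 2 - 1 = m + 1 by ring]
  field_simp

theorem nnRadius_pos {n : ℕ} (hn : 2 ≤ n) {s : ℝ} (hs : 0 < s) : 0 < nnRadius d n s := by
  have h1 : (2 : ℝ) ≤ n := by exact_mod_cast hn
  exact Real.rpow_pos_of_pos (div_pos hs (mul_pos (by linarith) (unitBallVolume_pos d))) _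

/-- Lebesgue differentiation: the expected number of sample points in a ball of volume
`s / (n - 1)` around `x` tends to `s f(x)`. -/
theorem ae_tendsto_mul_measureReal_closedBall (hd : 1 ≤ d) (hf : IsProbDensity f) {s : ℝ}
    (hs : 0 < s) :
    ∀ᵐ x ∂densityLaw f, Tendsto (fun m : ℕ => ((m : ℝ) + 1) *
      (densityLaw f).real (Metric.closedBall x (nnRadius d (m + 2) s))) atTop (𝓝 (s * f x)) := by
  have := isProbabilityMeasure_densityLaw hf
  have hfm := hf.measurable
  refine (withDensity_absolutelyContinuous _ _).ae_le ?_
  filter_upwards [Besicovitch.ae_tendsto_rnDeriv (densityLaw f) volume,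
    Measure.rnDeriv_withDensity volume (f := fun x => ENNReal.ofReal (f x)) (by fun_prop)]
    with x hx hx2
  have hr : Tendsto (fun m : ℕ => nnRadius d (m + 2) s) atTop (𝓝[>] 0) :=
    tendsto_nhdsWithin_iff.2 ⟨tendsto_nnRadius hd s,
      Eventually.of_forall fun m => nnRadius_pos (by omega) hs⟩
  have h := hx.comp hr
  have hval : (densityLaw f).rnDeriv volume x = ENNReal.ofReal (f x) := hx2
  rw [hval] at h
  have h2 := ((ENNReal.tendsto_toReal ENNReal.ofReal_ne_top).comp h).const_mul s
  rw [ENNReal.toReal_ofReal (hf.nonneg x)] at h2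
  refine h2.congr fun m => ?_
  have hv := volume_closedBall_nnRadius (d := d) hd (show 2 ≤ m + 2 by omega) hs.le x
  have hv2 := congrArg ENNReal.toReal hv
  rw [ENNReal.toReal_mul, ENNReal.toReal_ofReal hs.le, ENNReal.toReal_natCast] at hv2
  simp only [Function.comp, ENNReal.toReal_div, measureReal_def]
  have hpos : (volume (Metric.closedBall x (nnRadius d (m + 2) s))).toReal ≠ 0 := by
    intro h0
    rw [h0, mul_zero] at hv2
    exact hs.ne hv2
  have hm : ((m + 2 - 1 : ℕ) : ℝ) = m + 1 := by push_cast; ring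
  rw [hm] at hv2
  generalize (volume (Metric.closedBall x (nnRadius d (m + 2) s))).toReal = V at hv2 hpos ⊢
  generalize ((densityLaw f) (Metric.closedBall x (nnRadius d (m + 2) s))).toReal = q
  rw [← hv2]
  field_simp

theorem measurable_measureReal_closedBall (μ : Measure (EuclideanSpace ℝ (Fin d)))
    [IsFiniteMeasure μ] (r : ℝ) : Measurable (fun x => μ.real (Metric.closedBall x r)) :=
  (measurable_measure_closedBall μ r).ennreal_toReal

theorem measurable_measureReal_union_closedBall (μ : Measure (EuclideanSpace ℝ (Fin d)))
    [IsFiniteMeasure μ] (r : ℝ) :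
    Measurable (fun z : EuclideanSpace ℝ (Fin d) × EuclideanSpace ℝ (Fin d) =>
      μ.real (Metric.closedBall z.1 r ∪ Metric.closedBall z.2 r)) := by
  have hS : MeasurableSet {p : (EuclideanSpace ℝ (Fin d) × EuclideanSpace ℝ (Fin d)) ×
      EuclideanSpace ℝ (Fin d) | dist p.2 p.1.1 ≤ r ∨ dist p.2 p.1.2 ≤ r} := by
    have h1 : Measurable fun p : (EuclideanSpace ℝ (Fin d) × EuclideanSpace ℝ (Fin d)) ×
      EuclideanSpace ℝ (Fin d) => dist p.2 p.1.1 := by fun_prop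
    have h2 : Measurable fun p : (EuclideanSpace ℝ (Fin d) × EuclideanSpace ℝ (Fin d)) ×
      EuclideanSpace ℝ (Fin d) => dist p.2 p.1.2 := by fun_prop
    exact (measurableSet_le h1 measurable_const).union (measurableSet_le h2 measurable_const)
  exact (measurable_measure_prodMk_left hS).ennreal_toReal

theorem tendsto_integral_isolated (hd : 1 ≤ d) (hf : IsProbDensity f) (u : ℝ) :
    Tendsto (fun m : ℕ => ∫ x, (1 - (densityLaw f).real
      (Metric.closedBall x (nnRadius d (m + 2) (Real.exp u)))) ^ (m + 1) ∂densityLaw f) atTop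
      (𝓝 (limitTail f u)) := by
  have := isProbabilityMeasure_densityLaw hf
  refine tendsto_integral_of_dominated_convergence (fun _ => 1) (fun m => ?_)
    (integrable_const _) (fun m => Eventually.of_forall fun x => ?_) ?_
  · exact ((measurable_const.sub (measurable_measureReal_closedBall _ _)).pow_const
      _).aestronglyMeasurable
  · have h0 : 0 ≤ 1 - (densityLaw f).real
        (Metric.closedBall x (nnRadius d (m + 2) (Real.exp u))) := sub_nonneg.2 measureReal_le_one
    rw [Real.norm_eq_abs, abs_of_nonneg (pow_nonneg h0 _)]
    exact pow_le_one₀ h0 (sub_le_self _ measureReal_nonneg)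
  · filter_upwards [ae_tendsto_mul_measureReal_closedBall hd hf (Real.exp_pos u)] with x hx
    exact tendsto_one_sub_pow_succ hx

/-- Asymptotic independence: for distinct centres the two shrinking balls are eventually disjoint,
so the probability that both are avoided factorises in the limit. -/
theorem tendsto_integral_isolated_pair (hd : 1 ≤ d) (hf : IsProbDensity f) (u : ℝ) :
    Tendsto (fun m : ℕ => ∫ z, (1 - (densityLaw f).real
      (Metric.closedBall z.1 (nnRadius d (m + 2) (Real.exp u)) ∪
        Metric.closedBall z.2 (nnRadius d (m + 2) (Real.exp u)))) ^ m
        ∂((densityLaw f).prod (densityLaw f))) atTop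
      (𝓝 (limitTail f u ^ 2)) := by
  have := isProbabilityMeasure_densityLaw hf
  have := nullSingletonClass_densityLaw (f := f) hd
  have hlim : limitTail f u ^ 2 = ∫ z : EuclideanSpace ℝ (Fin d) × EuclideanSpace ℝ (Fin d),
      Real.exp (-(Real.exp u * f z.1 + Real.exp u * f z.2))
        ∂((densityLaw f).prod (densityLaw f)) := by
    rw [sq, limitTail, ← integral_prod_mul]
    refine integral_congr_ae (Eventually.of_forall fun z => ?_)
    simp only [← Real.exp_add]
    congr 1
    ring
  rw [hlim]
  refine tendsto_integral_of_dominated_convergence (fun _ => 1) (fun m => ?_)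
    (integrable_const _) (fun m => Eventually.of_forall fun x => ?_) ?_
  · exact ((measurable_const.sub (measurable_measureReal_union_closedBall _ _)).pow_const
      _).aestronglyMeasurable
  · have h0 : ∀ S, 0 ≤ 1 - (densityLaw f).real S := fun S => sub_nonneg.2 measureReal_le_one
    rw [Real.norm_eq_abs, abs_of_nonneg (pow_nonneg (h0 _) _)]
    exact pow_le_one₀ (h0 _) (sub_le_self _ measureReal_nonneg)
  · have hae := ae_tendsto_mul_measureReal_closedBall hd hf (Real.exp_pos u)
    have hdiag : ∀ᵐ z ∂((densityLaw f).prod (densityLaw f)), z.1 ≠ z.2 := by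
      have hm : MeasurableSet {z : EuclideanSpace ℝ (Fin d) × EuclideanSpace ℝ (Fin d) |
          z.1 = z.2} := measurableSet_eq_fun measurable_fst measurable_snd
      have h0 : (densityLaw f).prod (densityLaw f) {z | z.1 = z.2} = 0 := by
        rw [Measure.measure_prod_null hm]
        refine Eventually.of_forall fun x => ?_
        have : Prod.mk x ⁻¹' {z : EuclideanSpace ℝ (Fin d) × EuclideanSpace ℝ (Fin d) |
          z.1 = z.2} = {x} := by ext y; simp [eq_comm]
        simp [this]
      rw [ae_iff]
      simpa using h0
    filter_upwards [hdiag, Measure.quasiMeasurePreserving_fst.ae hae,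
      Measure.quasiMeasurePreserving_snd.ae hae] with z hz h1 h2
    refine tendsto_one_sub_pow ((h1.add h2).congr' ?_)
    have hev : ∀ᶠ m : ℕ in atTop, nnRadius d (m + 2) (Real.exp u) < dist z.1 z.2 / 2 :=
      (tendsto_nnRadius hd _).eventually_lt_const (half_pos (dist_pos.2 hz))
    filter_upwards [hev] with m hm
    rw [measureReal_union (Metric.closedBall_disjoint_closedBall (by linarith))
      Metric.isClosed_closedBall.measurableSet]
    ring

end Limit

/-! ### Second moments of empirical fractions -/

/-- Second moment bound for the fraction of events `A i` that occur, centred at `p`, from the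
probabilities `a` of the events and an upper bound `b` for those of their pairwise
intersections. -/
theorem integral_sq_average_sub_le {α : Type*} [MeasurableSpace α] (P : Measure α)
    [IsProbabilityMeasure P] {n : ℕ} (hn : 0 < n) {A : Fin n → Set α}
    (hA : ∀ i, MeasurableSet (A i)) {a b : ℝ} (p : ℝ) (ha : ∀ i, P.real (A i) = a)
    (hb0 : 0 ≤ b) (hb : ∀ i j, i ≠ j → P.real (A i ∩ A j) ≤ b) :
    ∫ ω, ((1 / (n : ℝ)) * ∑ i, (A i).indicator 1 ω - p) ^ 2 ∂P
      ≤ 1 / n + b - 2 * p * a + p ^ 2 := by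
  have hn' : (0 : ℝ) < n := by exact_mod_cast hn
  have hexp : ∀ ω, ((1 / (n : ℝ)) * ∑ i, (A i).indicator (1 : α → ℝ) ω - p) ^ 2
      = (1 / (n : ℝ)) ^ 2 * (∑ i, ∑ j, (A i ∩ A j).indicator (1 : α → ℝ) ω)
        - 2 * p * (1 / n) * (∑ i, (A i).indicator (1 : α → ℝ) ω) + p ^ 2 := by
    intro ω
    have : (∑ i, (A i).indicator (1 : α → ℝ) ω) ^ 2
        = ∑ i, ∑ j, (A i ∩ A j).indicator (1 : α → ℝ) ω := by
      rw [sq, Finset.sum_mul_sum]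
      simp_rw [Set.inter_indicator_one, Pi.mul_apply]
    rw [← this]
    ring
  have hi1 : ∀ B : Set α, MeasurableSet B → Integrable (B.indicator (1 : α → ℝ)) P := fun B hB =>
    (integrable_const (1 : ℝ)).indicator hB
  have hint1 : Integrable (fun ω => ∑ i, (A i).indicator (1 : α → ℝ) ω) P :=
    integrable_finsetSum _ fun i _ => hi1 _ (hA i)
  have hint2 : Integrable (fun ω => ∑ i, ∑ j, (A i ∩ A j).indicator (1 : α → ℝ) ω) P :=
    integrable_finsetSum _ fun i _ => integrable_finsetSum _ fun j _ =>
      hi1 _ ((hA i).inter (hA j))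
  have hint12 : Integrable (fun ω => (1 / (n : ℝ)) ^ 2 *
      (∑ i, ∑ j, (A i ∩ A j).indicator (1 : α → ℝ) ω)
        - 2 * p * (1 / n) * (∑ i, (A i).indicator (1 : α → ℝ) ω)) P :=
    (hint2.const_mul _).sub (hint1.const_mul _)
  simp_rw [hexp]
  rw [integral_add hint12 (integrable_const _),
    integral_sub (hint2.const_mul _) (hint1.const_mul _), integral_const_mul, integral_const_mul,
    integral_finsetSum _ (fun i _ => integrable_finsetSum _ fun j _ =>
      hi1 _ ((hA i).inter (hA j))),
    integral_finsetSum _ (fun i _ => hi1 _ (hA i))]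
  have hin : ∀ i, ∫ ω, ∑ j, (A i ∩ A j).indicator (1 : α → ℝ) ω ∂P ≤ 1 + n * b := by
    intro i
    rw [integral_finsetSum _ (fun j _ => hi1 _ ((hA i).inter (hA j)))]
    simp_rw [integral_indicator_one ((hA i).inter (hA _))]
    rw [← Finset.add_sum_erase _ _ (Finset.mem_univ i)]
    refine add_le_add measureReal_le_one ?_
    refine (Finset.sum_le_card_nsmul _ _ b fun j hj => hb i j
      (Finset.ne_of_mem_erase hj).symm).trans ?_
    rw [nsmul_eq_mul]
    gcongr
    exact (Finset.card_erase_le).trans (by simp)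
  have hs1 : ∑ i, ∫ ω, ∑ j, (A i ∩ A j).indicator (1 : α → ℝ) ω ∂P ≤ n * (1 + n * b) := by
    refine (Finset.sum_le_sum fun i _ => hin i).trans (le_of_eq ?_)
    rw [Finset.sum_const, Finset.card_univ, Fintype.card_fin, nsmul_eq_mul]
  have hs2 : ∑ i, ∫ ω, (A i).indicator (1 : α → ℝ) ω ∂P = n * a := by
    simp_rw [integral_indicator_one (hA _), ha]
    simp
  rw [hs2]
  have h3 := mul_le_mul_of_nonneg_left hs1 (sq_nonneg (1 / (n : ℝ)))
  have h4 : (1 / (n : ℝ)) ^ 2 * (n * (1 + n * b)) = 1 / n + b := by field_simp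
  have h5 : 2 * p * (1 / n) * (n * a) = 2 * p * a := by field_simp
  rw [h4] at h3
  rw [h5]
  simp only [integral_const, probReal_univ, one_smul]
  linarith

theorem sq_integral_abs_le {α : Type*} [MeasurableSpace α] (P : Measure α)
    [IsProbabilityMeasure P] {Y : α → ℝ} (hY : Integrable Y P)
    (hY2 : Integrable (fun ω => Y ω ^ 2) P) :
    (∫ ω, |Y ω| ∂P) ^ 2 ≤ ∫ ω, Y ω ^ 2 ∂P := by
  set e := ∫ ω, |Y ω| ∂P with he
  have h : 0 ≤ ∫ ω, (|Y ω| - e) ^ 2 ∂P := integral_nonneg fun ω => sq_nonneg _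
  have hexp : ∀ ω, (|Y ω| - e) ^ 2 = Y ω ^ 2 - 2 * e * |Y ω| + e ^ 2 := fun ω => by
    rw [← sq_abs (Y ω)]; ring
  have hint : Integrable (fun ω => Y ω ^ 2 - 2 * e * |Y ω|) P := hY2.sub (hY.abs.const_mul _)
  simp_rw [hexp] at h
  rw [integral_add hint (integrable_const _),
    integral_sub hY2 (hY.abs.const_mul _), integral_const_mul, ← he] at h
  simp only [integral_const, probReal_univ, one_smul] at h
  nlinarith

/-! ### The estimate as an integral over levels -/

section Pathwise

variable {d : ℕ} {Ω : Type*} {X : ℕ → Ω → EuclideanSpace ℝ (Fin d)}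

/-- The event that the logarithm of the `i`-th normalised nearest neighbor volume exceeds `u`. -/
def tailEvent (X : ℕ → Ω → EuclideanSpace ℝ (Fin d)) (n : ℕ) (u : ℝ) (i : Fin n) : Set Ω :=
  {ω | u < Real.log (nnVolume X n i ω)}

/-- The fraction of sample points whose log-volume exceeds `u`. -/
noncomputable def tailFraction (X : ℕ → Ω → EuclideanSpace ℝ (Fin d)) (n : ℕ) (u : ℝ) (ω : Ω) :
    ℝ :=
  (1 / (n : ℝ)) * ∑ i, (tailEvent X n u i).indicator 1 ω

theorem tailFraction_mem_Icc (n : ℕ) (u : ℝ) (ω : Ω) : tailFraction X n u ω ∈ Set.Icc 0 1 := by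
  have h0 : ∀ i : Fin n, 0 ≤ (tailEvent X n u i).indicator (1 : Ω → ℝ) ω := fun i =>
    Set.indicator_nonneg (fun _ _ => zero_le_one) _
  have h1 : ∀ i : Fin n, (tailEvent X n u i).indicator (1 : Ω → ℝ) ω ≤ 1 := fun i =>
    Set.indicator_apply_le' (fun _ => le_rfl) fun _ => zero_le_one
  refine ⟨mul_nonneg (by positivity) (Finset.sum_nonneg fun i _ => h0 i), ?_⟩
  rcases Nat.eq_zero_or_pos n with rfl | hn
  · simp [tailFraction]
  · have hs := Finset.sum_le_sum fun i (_ : i ∈ Finset.univ) => h1 i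
    simp only [Finset.sum_const, Finset.card_univ, Fintype.card_fin, nsmul_eq_mul, mul_one] at hs
    rw [tailFraction, one_div, inv_mul_le_iff₀ (by exact_mod_cast hn), mul_one]
    exact hs

theorem estimateH_eq (X : ℕ → Ω → EuclideanSpace ℝ (Fin d)) (n : ℕ) (ω : Ω) :
    estimateH X n ω = (1 / (n : ℝ)) * ∑ i, Real.log (nnVolume X n i ω) + constCE := rfl

theorem tailFraction_sub_eq {n : ℕ} (hn : 0 < n) (u : ℝ) (ω : Ω) :
    tailFraction X n u ω - (if u < 0 then 1 else 0)
      = (1 / (n : ℝ)) * ∑ i, layer (Real.log (nnVolume X n i ω)) u := by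
  have hn' : (n : ℝ) ≠ 0 := by positivity
  simp only [layer, Finset.sum_sub_distrib, mul_sub, tailFraction, tailEvent]
  congr 1
  rw [Finset.sum_const, Finset.card_univ, Fintype.card_fin, nsmul_eq_mul]
  field_simp

/-- The error of the estimate is the integral over all levels of the difference between the
empirical and the limiting tail function. -/
theorem estimateH_sub_diffEntropy {f : EuclideanSpace ℝ (Fin d) → ℝ} (hf : IsProbDensity f)
    (hH : HasFiniteEntropy f) {n : ℕ} (hn : 0 < n) (ω : Ω) :
    estimateH X n ω - diffEntropy f = ∫ u, (tailFraction X n u ω - limitTail f u) := by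
  have h1 : Integrable fun u => (1 / (n : ℝ)) * ∑ i, layer (Real.log (nnVolume X n i ω)) u :=
    (integrable_finsetSum _ fun i _ => integrable_layer _).const_mul _
  have h2 := integrable_limitTail_sub hf hH
  have heq : ∀ u, tailFraction X n u ω - limitTail f u
      = (1 / (n : ℝ)) * ∑ i, layer (Real.log (nnVolume X n i ω)) u
        - (limitTail f u - (if u < 0 then 1 else 0)) := fun u => by
    rw [← tailFraction_sub_eq hn]
    ring
  simp_rw [heq]
  rw [integral_sub h1 h2, integral_limitTail_sub hf hH, integral_const_mul,
    integral_finsetSum _ fun i _ => integrable_layer _]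
  simp_rw [integral_layer]
  rw [estimateH_eq]
  ring

end Pathwise

/-! ### Mean convergence of the estimate -/

section TailFraction

variable {d : ℕ} {f : EuclideanSpace ℝ (Fin d) → ℝ} {Ω : Type*} [MeasurableSpace Ω]
  {P : Measure Ω} [IsProbabilityMeasure P] {X : ℕ → Ω → EuclideanSpace ℝ (Fin d)}

theorem measurable_log_nnVolume (hX : ∀ i, Measurable (X i)) {n : ℕ} (i : Fin n) :
    Measurable (fun ω => Real.log (nnVolume X n i ω)) :=
  (measurable_nnVolume hX i).log

theorem measurableSet_tailEvent (hX : ∀ i, Measurable (X i)) (n : ℕ) (u : ℝ) (i : Fin n) :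
    MeasurableSet (tailEvent X n u i) :=
  measurableSet_lt measurable_const (measurable_log_nnVolume hX i)

theorem tailEvent_ae_eq (hd : 1 ≤ d) (hf : IsProbDensity f) (hX : ∀ i, Measurable (X i))
    (hindep : iIndepFun X P) (hlaw : ∀ i, P.map (X i) = densityLaw f) {n : ℕ} (hn : 2 ≤ n)
    (u : ℝ) (i : Fin n) :
    tailEvent X n u i =ᵐ[P] {ω | Real.exp u < nnVolume X n i ω} := by
  have := isProbabilityMeasure_densityLaw hf
  have := nullSingletonClass_densityLaw (f := f) hd
  filter_upwards [ae_nnVolume_pos hd hX hindep hlaw hn i] with ω hω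
  exact propext (Real.lt_log_iff_exp_lt hω)

theorem measureReal_tailEvent (hd : 1 ≤ d) (hf : IsProbDensity f) (hX : ∀ i, Measurable (X i))
    (hindep : iIndepFun X P) (hlaw : ∀ i, P.map (X i) = densityLaw f) (m : ℕ) (u : ℝ)
    (i : Fin (m + 2)) :
    P.real (tailEvent X (m + 2) u i) = ∫ x, (1 - (densityLaw f).real
      (Metric.closedBall x (nnRadius d (m + 2) (Real.exp u)))) ^ (m + 1) ∂densityLaw f := by
  have := isProbabilityMeasure_densityLaw hf
  have hq := measurable_measure_closedBall (densityLaw f) (nnRadius d (m + 2) (Real.exp u))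
  have hc : ∀ x r, (densityLaw f) (Metric.closedBall x r)ᶜ
      = 1 - densityLaw f (Metric.closedBall x r) := fun x r =>
    prob_compl_eq_one_sub Metric.isClosed_closedBall.measurableSet
  rw [measureReal_def, measure_congr (tailEvent_ae_eq hd hf hX hindep hlaw (by omega) u i),
    measure_lt_nnVolume hd hX hindep hlaw (by omega) i (Real.exp_pos u).le,
    ← integral_toReal]
  · refine integral_congr_ae (Eventually.of_forall fun x => ?_)
    change (densityLaw f (Metric.closedBall x _)ᶜ ^ (m + 1)).toReal = _
    rw [ENNReal.toReal_pow, ← measureReal_def,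
      probReal_compl_eq_one_sub Metric.isClosed_closedBall.measurableSet]
  · simp_rw [hc]
    exact ((measurable_const.sub hq).pow_const _).aemeasurable
  · exact Eventually.of_forall fun x => ENNReal.pow_lt_top (measure_lt_top _ _)

theorem measureReal_tailEvent_inter_le (hd : 1 ≤ d) (hf : IsProbDensity f)
    (hX : ∀ i, Measurable (X i)) (hindep : iIndepFun X P)
    (hlaw : ∀ i, P.map (X i) = densityLaw f) (m : ℕ) (u : ℝ) {i j : Fin (m + 2)} (hij : i ≠ j) :
    P.real (tailEvent X (m + 2) u i ∩ tailEvent X (m + 2) u j)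
      ≤ ∫ z, (1 - (densityLaw f).real
      (Metric.closedBall z.1 (nnRadius d (m + 2) (Real.exp u)) ∪
        Metric.closedBall z.2 (nnRadius d (m + 2) (Real.exp u)))) ^ m
        ∂((densityLaw f).prod (densityLaw f)) := by
  have := isProbabilityMeasure_densityLaw hf
  set r := nnRadius d (m + 2) (Real.exp u) with hr
  have hU : ∀ z : EuclideanSpace ℝ (Fin d) × EuclideanSpace ℝ (Fin d),
      MeasurableSet (Metric.closedBall z.1 r ∪ Metric.closedBall z.2 r) := fun z =>
    Metric.isClosed_closedBall.measurableSet.union Metric.isClosed_closedBall.measurableSet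
  have h := measure_isolated_pair_le hX hindep hlaw i.2 j.2 (fun h => hij (Fin.ext h)) r
  have heq : P (tailEvent X (m + 2) u i ∩ tailEvent X (m + 2) u j)
      = P {ω | (∀ k ∈ (Finset.range (m + 2)).erase i, X k ω ∉ Metric.closedBall (X i ω) r) ∧
        ∀ k ∈ (Finset.range (m + 2)).erase j, X k ω ∉ Metric.closedBall (X j ω) r} := by
    rw [measure_congr ((tailEvent_ae_eq hd hf hX hindep hlaw (by omega) u i).inter
      (tailEvent_ae_eq hd hf hX hindep hlaw (by omega) u j))]
    congr 1
    ext ω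
    simp only [Set.mem_inter_iff, Set.mem_ofPred_eq,
      lt_nnVolume_iff hd (show 2 ≤ m + 2 by omega) _ ω (Real.exp_pos u).le, hr]
  rw [integral_eq_lintegral_of_nonneg_ae, measureReal_def, heq]
  · refine ENNReal.toReal_mono ?_ (h.trans (le_of_eq ?_))
    · refine ((lintegral_mono (g := fun _ => 1) fun z => ?_).trans_lt (by simp)).ne
      rw [ENNReal.ofReal_le_one]
      exact pow_le_one₀ (sub_nonneg.2 measureReal_le_one) (sub_le_self _ measureReal_nonneg)
    · refine lintegral_congr fun z => ?_
      rw [← probReal_compl_eq_one_sub (hU z), ENNReal.ofReal_pow measureReal_nonneg,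
        ofReal_measureReal]
      rfl
  · exact Eventually.of_forall fun z => pow_nonneg (sub_nonneg.2 measureReal_le_one) _
  · exact ((measurable_const.sub (measurable_measureReal_union_closedBall _ _)).pow_const
      _).aestronglyMeasurable

theorem measurable_tailFraction (hX : ∀ i, Measurable (X i)) (n : ℕ) (u : ℝ) :
    Measurable (tailFraction X n u) :=
  (Finset.measurable_fun_sum _ fun i _ =>
    measurable_one.indicator (measurableSet_tailEvent hX n u i)).const_mul _

/-- For each level `u` the fraction of points with log-volume above `u` converges in mean to
`limitTail f u`. -/
theorem tendsto_lintegral_tailFraction_sub (hd : 1 ≤ d) (hf : IsProbDensity f)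
    (hX : ∀ i, Measurable (X i)) (hindep : iIndepFun X P)
    (hlaw : ∀ i, P.map (X i) = densityLaw f) (u : ℝ) :
    Tendsto (fun n : ℕ => ∫⁻ ω, ‖tailFraction X n u ω - limitTail f u‖ₑ ∂P) atTop (𝓝 0) := by
  have := isProbabilityMeasure_densityLaw hf
  rw [← tendsto_add_atTop_iff_nat 2]
  set p := limitTail f u with hp
  have ha := tendsto_integral_isolated hd hf u
  have hb := tendsto_integral_isolated_pair hd hf u
  have hY : ∀ n, Measurable fun ω => tailFraction X n u ω - p := fun n =>
    (measurable_tailFraction hX n u).sub measurable_const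
  have hbd : ∀ n ω, |tailFraction X n u ω - p| ≤ 1 + |p| := fun n ω => by
    refine (abs_sub _ _).trans ?_
    have := tailFraction_mem_Icc (X := X) n u ω
    rw [abs_of_nonneg this.1]
    linarith [this.2]
  have hint : ∀ n, Integrable (fun ω => tailFraction X n u ω - p) P := fun n =>
    Integrable.of_bound (hY n).aestronglyMeasurable (1 + |p|)
      (Eventually.of_forall fun ω => hbd n ω)
  have hint2 : ∀ n, Integrable (fun ω => (tailFraction X n u ω - p) ^ 2) P := fun n =>
    Integrable.of_bound ((hY n).pow_const 2).aestronglyMeasurable ((1 + |p|) ^ 2)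
      (Eventually.of_forall fun ω => by
        rw [norm_pow, Real.norm_eq_abs]
        gcongr
        exact hbd n ω)
  have hsq : Tendsto (fun m : ℕ => (∫ ω, |tailFraction X (m + 2) u ω - p| ∂P) ^ 2) atTop
      (𝓝 0) := by
    have hn : Tendsto (fun m : ℕ => 1 / ((m + 2 : ℕ) : ℝ)) atTop (𝓝 0) :=
      (tendsto_add_atTop_iff_nat 2).2 tendsto_one_div_atTop_nhds_zero_nat
    have hup := ((hn.add hb).sub (ha.const_mul (2 * p))).add_const (p ^ 2)
    rw [show (0 : ℝ) + p ^ 2 - 2 * p * p + p ^ 2 = 0 by ring] at hup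
    refine squeeze_zero (fun m => sq_nonneg _) (fun m => ?_) hup
    refine (sq_integral_abs_le P (hint _) (hint2 _)).trans ?_
    exact integral_sq_average_sub_le P (by omega) (measurableSet_tailEvent hX (m + 2) u) p
      (measureReal_tailEvent hd hf hX hindep hlaw m u)
      (integral_nonneg fun z => pow_nonneg (sub_nonneg.2 measureReal_le_one) _)
      fun i j hij => measureReal_tailEvent_inter_le hd hf hX hindep hlaw m u hij
  have h1 : Tendsto (fun m : ℕ => ∫ ω, |tailFraction X (m + 2) u ω - p| ∂P) atTop (𝓝 0) := by
    have := hsq.sqrt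
    rw [Real.sqrt_zero] at this
    exact this.congr fun m => Real.sqrt_sq (integral_nonneg fun ω => abs_nonneg _)
  have h2 := ENNReal.tendsto_ofReal h1
  rw [ENNReal.ofReal_zero] at h2
  refine h2.congr fun m => ?_
  exact ofReal_integral_norm_eq_lintegral_enorm (hint _)

/-- Majorant of the mean absolute layer function of the log-volumes, at any sample size. -/
noncomputable def layerMajorant (f : EuclideanSpace ℝ (Fin d) → ℝ) (u : ℝ) : ℝ≥0∞ :=
  if u < 0 then lowerMajorant f u else upperMajorant (densityLaw f) u

theorem lintegral_layerMajorant_ne_top (hd : 1 ≤ d) (hf : IsProbDensity f)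
    (hH : HasFiniteEntropy f)
    (hlog : ∫⁻ x, ENNReal.ofReal (max (Real.log ‖x‖) 0) ∂densityLaw f < ⊤) :
    ∫⁻ u, layerMajorant f u ≠ ⊤ := by
  have := isProbabilityMeasure_densityLaw hf
  rw [← lintegral_add_compl _ (measurableSet_Iio (a := (0 : ℝ)))]
  refine (ENNReal.add_lt_top.2 ⟨?_, ?_⟩).ne
  · refine lt_of_eq_of_lt (setLIntegral_congr_fun measurableSet_Iio fun u (hu : u < 0) => ?_)
      (lintegral_lowerMajorant_lt_top hf hH)
    simp [layerMajorant, hu]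
  · rw [Set.compl_Iio, setLIntegral_congr Ioi_ae_eq_Ici.symm]
    refine lt_of_eq_of_lt (setLIntegral_congr_fun measurableSet_Ioi fun u (hu : 0 < u) => ?_)
      (lintegral_upperMajorant_lt_top hd (densityLaw f) hlog)
    simp [layerMajorant, hu.not_gt]

theorem lintegral_enorm_layer_le (hd : 1 ≤ d) (hf : IsProbDensity f)
    (hX : ∀ i, Measurable (X i)) (hindep : iIndepFun X P)
    (hlaw : ∀ i, P.map (X i) = densityLaw f) {n : ℕ} (hn : 2 ≤ n) (i : Fin n) (u : ℝ) :
    ∫⁻ ω, ‖layer (Real.log (nnVolume X n i ω)) u‖ₑ ∂P ≤ layerMajorant f u := by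
  have := isProbabilityMeasure_densityLaw hf
  have hm := measurableSet_tailEvent hX n u i
  have hae := tailEvent_ae_eq hd hf hX hindep hlaw hn u i
  rw [layerMajorant]
  split_ifs with hu
  · refine le_trans ?_ (measure_nnVolume_le_le hd hf hX hindep hlaw hn i u)
    have hc : {ω | nnVolume X n i ω ≤ Real.exp u} = {ω | Real.exp u < nnVolume X n i ω}ᶜ := by
      ext ω; simp
    rw [hc, ← measure_congr hae.compl, ← lintegral_indicator_one hm.compl]
    refine lintegral_mono fun ω => ?_
    by_cases h : u < Real.log (nnVolume X n i ω) <;>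
      simp [layer, hu, h, tailEvent]
  · refine le_trans ?_ (measure_lt_nnVolume_le hd hX hindep hlaw hn i u)
    rw [← measure_congr hae, ← lintegral_indicator_one hm]
    refine lintegral_mono fun ω => ?_
    by_cases h : u < Real.log (nnVolume X n i ω) <;>
      simp [layer, hu, h, tailEvent]

theorem lintegral_enorm_tailFraction_sub_le (hd : 1 ≤ d) (hf : IsProbDensity f)
    (hX : ∀ i, Measurable (X i)) (hindep : iIndepFun X P)
    (hlaw : ∀ i, P.map (X i) = densityLaw f) {n : ℕ} (hn : 2 ≤ n) (u : ℝ) :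
    ∫⁻ ω, ‖tailFraction X n u ω - limitTail f u‖ₑ ∂P
      ≤ layerMajorant f u + ‖limitTail f u - (if u < 0 then 1 else 0)‖ₑ := by
  have hn0 : (n : ℝ≥0∞) ≠ 0 := by simp; omega
  have hlm : ∀ i : Fin n, Measurable fun ω => ‖layer (Real.log (nnVolume X n i ω)) u‖ₑ :=
    fun i => (measurable_layer.comp
      ((measurable_log_nnVolume hX i).prodMk measurable_const)).enorm
  calc ∫⁻ ω, ‖tailFraction X n u ω - limitTail f u‖ₑ ∂P
      ≤ ∫⁻ ω, ((n : ℝ≥0∞)⁻¹ * (∑ i, ‖layer (Real.log (nnVolume X n i ω)) u‖ₑ)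
          + ‖limitTail f u - (if u < 0 then 1 else 0)‖ₑ) ∂P := by
        refine lintegral_mono fun ω => ?_
        have h : tailFraction X n u ω - limitTail f u
            = (1 / (n : ℝ)) * ∑ i, layer (Real.log (nnVolume X n i ω)) u
              - (limitTail f u - (if u < 0 then 1 else 0)) := by
          rw [← tailFraction_sub_eq (by omega)]
          ring
        rw [h]
        refine enorm_sub_le.trans ?_
        gcongr
        rw [enorm_mul]
        gcongr
        · rw [one_div, enorm_inv (by positivity)]
          simp
        · exact enorm_sum_le _ _
    _ = (n : ℝ≥0∞)⁻¹ * (∑ i : Fin n, ∫⁻ ω, ‖layer (Real.log (nnVolume X n i ω)) u‖ₑ ∂P)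
          + ‖limitTail f u - (if u < 0 then 1 else 0)‖ₑ := by
        rw [lintegral_add_right _ measurable_const,
          lintegral_const_mul _ (Finset.measurable_fun_sum _ fun i _ => hlm i),
          lintegral_finsetSum _ fun i _ => hlm i]
        simp
    _ ≤ (n : ℝ≥0∞)⁻¹ * (n * layerMajorant f u)
          + ‖limitTail f u - (if u < 0 then 1 else 0)‖ₑ := by
        gcongr
        refine (Finset.sum_le_sum fun i _ =>
          lintegral_enorm_layer_le hd hf hX hindep hlaw hn i u).trans ?_
        simp
    _ = _ := by
        rw [← mul_assoc, ENNReal.inv_mul_cancel hn0 (ENNReal.natCast_ne_top _), one_mul]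

theorem measurable_limitTail (hf : IsProbDensity f) : Measurable (limitTail f) := by
  have := isProbabilityMeasure_densityLaw hf
  have hfm := hf.measurable
  have h : StronglyMeasurable (fun p : ℝ × EuclideanSpace ℝ (Fin d) =>
      Real.exp (-(Real.exp p.1 * f p.2))) := by
    refine Measurable.stronglyMeasurable ?_
    fun_prop
  exact h.integral_prod_right.measurable

theorem measurable_tailFraction_uncurry (hX : ∀ i, Measurable (X i)) (n : ℕ) :
    Measurable fun p : ℝ × Ω => tailFraction X n p.1 p.2 := by
  unfold tailFraction
  refine (Finset.measurable_fun_sum _ fun i _ => ?_).const_mul _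
  have hS : MeasurableSet {p : ℝ × Ω | p.1 < Real.log (nnVolume X n i p.2)} :=
    measurableSet_lt measurable_fst ((measurable_log_nnVolume hX i).comp measurable_snd)
  exact (measurable_one (α := ℝ)).indicator hS

/-- Sufficiency of the logarithmic moment: mean consistency of the estimate. -/
theorem tendsto_lintegral_estimateH_sub (hd : 1 ≤ d) (hf : IsProbDensity f)
    (hH : HasFiniteEntropy f) (hX : ∀ i, Measurable (X i)) (hindep : iIndepFun X P)
    (hlaw : ∀ i, P.map (X i) = densityLaw f)
    (hlog : ∫⁻ x, ENNReal.ofReal (max (Real.log ‖x‖) 0) ∂densityLaw f < ⊤) :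
    Tendsto (fun n : ℕ => ∫⁻ ω, ENNReal.ofReal |estimateH X n ω - diffEntropy f| ∂P)
      atTop (𝓝 0) := by
  rw [← tendsto_add_atTop_iff_nat 2]
  have hmeas : ∀ n, Measurable fun p : ℝ × Ω => ‖tailFraction X n p.1 p.2 - limitTail f p.1‖ₑ :=
    fun n => ((measurable_tailFraction_uncurry hX n).sub
      ((measurable_limitTail hf).comp measurable_fst)).enorm
  have hlim : Tendsto (fun m : ℕ =>
      ∫⁻ u, ∫⁻ ω, ‖tailFraction X (m + 2) u ω - limitTail f u‖ₑ ∂P) atTop (𝓝 0) := by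
    have h := tendsto_lintegral_of_dominated_convergence (μ := (volume : Measure ℝ))
      (F := fun m u => ∫⁻ ω, ‖tailFraction X (m + 2) u ω - limitTail f u‖ₑ ∂P)
      (f := fun _ => 0)
      (fun u => layerMajorant f u + ‖limitTail f u - (if u < 0 then 1 else 0)‖ₑ)
      (fun m => (hmeas (m + 2)).lintegral_prod_right')
      (fun m => Eventually.of_forall fun u =>
        lintegral_enorm_tailFraction_sub_le hd hf hX hindep hlaw (by omega) u)
      ?_ (Eventually.of_forall fun u => (tendsto_add_atTop_iff_nat 2).2
        (tendsto_lintegral_tailFraction_sub hd hf hX hindep hlaw u))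
    · simpa using h
    · have hi := integrable_limitTail_sub hf hH
      rw [lintegral_add_right' _ hi.aestronglyMeasurable.enorm]
      exact ENNReal.add_ne_top.2 ⟨lintegral_layerMajorant_ne_top hd hf hH hlog,
        hi.hasFiniteIntegral.ne⟩
  refine tendsto_of_tendsto_of_tendsto_of_le_of_le tendsto_const_nhds hlim
    (fun _ => zero_le) fun m => ?_
  change ∫⁻ ω, ENNReal.ofReal |estimateH X (m + 2) ω - diffEntropy f| ∂P ≤ _
  calc ∫⁻ ω, ENNReal.ofReal |estimateH X (m + 2) ω - diffEntropy f| ∂P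
      ≤ ∫⁻ ω, ∫⁻ u, ‖tailFraction X (m + 2) u ω - limitTail f u‖ₑ ∂volume ∂P := by
        refine lintegral_mono fun ω => ?_
        rw [← Real.enorm_eq_ofReal_abs, estimateH_sub_diffEntropy hf hH (by omega)]
        exact enorm_integral_le_lintegral_enorm _
    _ = _ := lintegral_lintegral_swap ((hmeas (m + 2)).comp measurable_swap).aemeasurable

end TailFraction

/-! ### The extended expectation of the estimate -/

theorem ennreal_ofReal_sum_le {ι : Type*} (s : Finset ι) (g : ι → ℝ) :
    ENNReal.ofReal (∑ i ∈ s, g i) ≤ ∑ i ∈ s, ENNReal.ofReal (g i) :=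
  Finset.le_sum_of_subadditive _ ENNReal.ofReal_zero.le (fun _ _ => ENNReal.ofReal_add_le) s g

theorem bot_lt_extExp {Ω : Type*} [MeasurableSpace Ω] {P : Measure Ω} {Y : Ω → ℝ}
    (h : expNeg P Y < ⊤) : ⊥ < extExp P Y := by
  rw [extExp, bot_lt_iff_ne_bot, sub_eq_add_neg, Ne, EReal.add_eq_bot_iff, not_or]
  refine ⟨EReal.coe_ennreal_ne_bot _, fun h' => h.ne ?_⟩
  rw [EReal.neg_eq_bot_iff] at h'
  exact EReal.coe_ennreal_eq_top_iff.1 h'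

theorem extExp_eq_top {Ω : Type*} [MeasurableSpace Ω] {P : Measure Ω} {Y : Ω → ℝ}
    (h : expNeg P Y < ⊤) (h' : expPos P Y = ⊤) :
    extExp P Y = ⊤ := by
  rw [extExp, h', EReal.coe_ennreal_top, sub_eq_add_neg, EReal.top_add_of_ne_bot]
  rw [Ne, EReal.neg_eq_bot_iff, EReal.coe_ennreal_eq_top_iff]
  exact h.ne

section Expectation

variable {d : ℕ} {f : EuclideanSpace ℝ (Fin d) → ℝ} {Ω : Type*} [MeasurableSpace Ω]
  {P : Measure Ω} [IsProbabilityMeasure P] {X : ℕ → Ω → EuclideanSpace ℝ (Fin d)}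

theorem expNeg_log_nnVolume_lt_top (hd : 1 ≤ d) (hf : IsProbDensity f) (hH : HasFiniteEntropy f)
    (hX : ∀ i, Measurable (X i)) (hindep : iIndepFun X P)
    (hlaw : ∀ i, P.map (X i) = densityLaw f) {n : ℕ} (hn : 2 ≤ n) (i : Fin n) :
    expNeg P (fun ω => Real.log (nnVolume X n i ω)) < ⊤ := by
  have := isProbabilityMeasure_densityLaw hf
  have := nullSingletonClass_densityLaw (f := f) hd
  have hm := measurable_log_nnVolume hX i
  unfold expNeg
  rw [← lintegral_tail_eq P (Y := fun ω => -Real.log (nnVolume X n i ω)) hm.neg]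
  refine lt_of_le_of_lt ?_ (lintegral_lowerMajorant_lt_top hf hH)
  rw [setLIntegral_Iio_eq_Ioi]
  refine lintegral_mono fun t => ?_
  refine (measure_mono_ae ?_).trans (measure_nnVolume_le_le hd hf hX hindep hlaw hn i (-t))
  filter_upwards [ae_nnVolume_pos hd hX hindep hlaw hn i] with ω hω hlt
  have h1 : t < -Real.log (nnVolume X n i ω) := hlt
  exact (Real.log_le_iff_le_exp hω).1 (by linarith)

theorem expNeg_estimateH_lt_top (hd : 1 ≤ d) (hf : IsProbDensity f) (hH : HasFiniteEntropy f)
    (hX : ∀ i, Measurable (X i)) (hindep : iIndepFun X P)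
    (hlaw : ∀ i, P.map (X i) = densityLaw f) {n : ℕ} (hn : 2 ≤ n) :
    expNeg P (estimateH X n) < ⊤ := by
  have hm : ∀ i : Fin n, Measurable fun ω => ENNReal.ofReal (-Real.log (nnVolume X n i ω)) :=
    fun i => (measurable_log_nnVolume hX i).neg.ennreal_ofReal
  have hn1 : 1 / (n : ℝ) ≤ 1 := by
    rw [div_le_one (by positivity)]
    exact_mod_cast (by omega : 1 ≤ n)
  calc expNeg P (estimateH X n)
      ≤ ∫⁻ ω, ((∑ i : Fin n, ENNReal.ofReal (-Real.log (nnVolume X n i ω)))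
          + ENNReal.ofReal (-constCE)) ∂P := by
        refine lintegral_mono fun ω => ?_
        have h : -estimateH X n ω
            = (1 / (n : ℝ)) * (∑ i, -Real.log (nnVolume X n i ω)) + -constCE := by
          rw [estimateH_eq, Finset.sum_neg_distrib]
          ring
        rw [h]
        refine ENNReal.ofReal_add_le.trans ?_
        gcongr
        rw [ENNReal.ofReal_mul (by positivity)]
        refine (mul_le_of_le_one_left' (ENNReal.ofReal_le_one.2 hn1)).trans ?_
        exact ennreal_ofReal_sum_le _ _
    _ = (∑ i : Fin n, expNeg P (fun ω => Real.log (nnVolume X n i ω)))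
          + ENNReal.ofReal (-constCE) := by
        rw [lintegral_add_right _ measurable_const, lintegral_finsetSum _ fun i _ => hm i]
        simp [expNeg]
    _ < ⊤ := ENNReal.add_lt_top.2 ⟨ENNReal.sum_lt_top.2 fun i _ =>
        expNeg_log_nnVolume_lt_top hd hf hH hX hindep hlaw hn i, ENNReal.ofReal_lt_top⟩

theorem exists_pos_measure_closedBall_ne_zero (μ : Measure (EuclideanSpace ℝ (Fin d)))
    [IsProbabilityMeasure μ] : ∃ M : ℝ, 0 < M ∧ μ (Metric.closedBall 0 M) ≠ 0 := by
  by_contra! h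
  have hU : ⋃ k : ℕ, Metric.closedBall (0 : EuclideanSpace ℝ (Fin d)) ((k : ℝ) + 1) = Set.univ := by
    refine Set.eq_univ_of_forall fun x => Set.mem_iUnion.2 ?_
    obtain ⟨k, hk⟩ := exists_nat_ge ‖x‖
    exact ⟨k, mem_closedBall_zero_iff.2 (by linarith)⟩
  have h0 : μ Set.univ = 0 := by
    rw [← hU]
    exact measure_iUnion_null fun k => h _ (by positivity)
  simp at h0

/-- If the logarithmic moment is infinite, so is the positive part of the expectation of the first
log-volume: with positive probability, independently of `X 0`, all other points lie in a fixed
ball, and then the nearest neighbor distance of `X 0` is comparable to `‖X 0‖`. -/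
theorem expPos_log_nnVolume_eq_top (hd : 1 ≤ d) {μ : Measure (EuclideanSpace ℝ (Fin d))}
    [IsProbabilityMeasure μ] (hX : ∀ i, Measurable (X i)) (hindep : iIndepFun X P)
    (hlaw : ∀ i, P.map (X i) = μ)
    (hlog : ∫⁻ ω, ENNReal.ofReal (max (Real.log ‖X 0 ω‖) 0) ∂P = ⊤) {n : ℕ} (hn : 2 ≤ n) :
    expPos P (fun ω => Real.log (nnVolume X n ⟨0, by omega⟩ ω)) = ⊤ := by
  obtain ⟨M, hM, hMμ⟩ := exists_pos_measure_closedBall_ne_zero μ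
  have hv := unitBallVolume_pos d
  have hn1 : (2 : ℝ) ≤ n := by exact_mod_cast hn
  have hd1 : (1 : ℝ) ≤ d := by exact_mod_cast hd
  set S := (Finset.range n).erase 0 with hS
  set G : Set Ω := {ω | ∀ k ∈ S, X k ω ∈ Metric.closedBall 0 M} with hG
  have hB : MeasurableSet (Metric.closedBall (0 : EuclideanSpace ℝ (Fin d)) M) :=
    Metric.isClosed_closedBall.measurableSet
  have hGm : MeasurableSet G := by
    have : G = ⋂ k ∈ S, X k ⁻¹' Metric.closedBall 0 M := by ext ω; simp [hG]
    rw [this]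
    exact Finset.measurableSet_biInter _ fun k _ => hX k hB
  have hind : IndepFun (X 0) (fun ω (k : S) => X k ω) P := by
    have h := hindep.indepFun_finset {0} S (by simp [hS]) hX
    exact h.comp (φ := fun g : ({0} : Finset ℕ) → EuclideanSpace ℝ (Fin d) => g ⟨0, by simp⟩)
      (measurable_pi_apply _) measurable_id
  have hPG : P G ≠ 0 := by
    have h := hindep.measure_inter_preimage_eq_mul S (sets := fun _ => Metric.closedBall 0 M)
      (fun _ _ => hB)
    have hG' : G = ⋂ k ∈ S, X k ⁻¹' Metric.closedBall 0 M := by ext ω; simp [hG]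
    rw [hG', h, Finset.prod_ne_zero_iff]
    intro k _
    rw [← Measure.map_apply (hX k) hB, hlaw k]
    exact hMμ
  set g : EuclideanSpace ℝ (Fin d) → ℝ≥0∞ := fun x => ENNReal.ofReal (max (Real.log ‖x‖) 0) with hg
  have hgm : Measurable g := by fun_prop
  have hprod : ∫⁻ ω, g (X 0 ω) * G.indicator 1 ω ∂P = ⊤ := by
    have hC : MeasurableSet {z : S → EuclideanSpace ℝ (Fin d) |
        ∀ k, z k ∈ Metric.closedBall 0 M} := by
      have : {z : S → EuclideanSpace ℝ (Fin d) | ∀ k, z k ∈ Metric.closedBall 0 M}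
          = Set.univ.pi fun _ => Metric.closedBall 0 M := by ext z; simp
      rw [this]
      exact MeasurableSet.univ_pi fun _ => hB
    have hind2 : IndepFun (fun ω => g (X 0 ω)) (G.indicator (1 : Ω → ℝ≥0∞)) P := by
      have h := hind.comp hgm ((measurable_one (α := ℝ≥0∞)).indicator hC)
      have h2 : (Set.indicator {z : S → EuclideanSpace ℝ (Fin d) |
          ∀ k, z k ∈ Metric.closedBall 0 M} (1 : (S → EuclideanSpace ℝ (Fin d)) → ℝ≥0∞))
            ∘ (fun ω (k : S) => X k ω)
          = G.indicator 1 := by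
        funext ω
        exact Set.indicator_eq_indicator (by simp [hG]) rfl
      rw [h2] at h
      exact h
    have h := lintegral_mul_eq_lintegral_mul_lintegral_of_indepFun (hgm.comp (hX 0))
      (measurable_one.indicator hGm) hind2
    refine h.trans ?_
    change (∫⁻ ω, ENNReal.ofReal (max (Real.log ‖X 0 ω‖) 0) ∂P) * _ = ⊤
    rw [hlog, lintegral_indicator_one hGm, ENNReal.top_mul hPG]
  by_contra hfin
  set c : ℝ := |Real.log ((n - 1) * unitBallVolume d) - d * Real.log 2| with hc
  set K : ℝ := c + max (Real.log (2 * M)) 0 with hK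
  have hbound : ∀ ω, g (X 0 ω) * G.indicator 1 ω
      ≤ ENNReal.ofReal (Real.log (nnVolume X n ⟨0, by omega⟩ ω)) + ENNReal.ofReal K := by
    intro ω
    by_cases hω : ω ∈ G
    · rw [Set.indicator_of_mem hω, Pi.one_apply, mul_one, hg]
      have hc0 : 0 ≤ c := abs_nonneg _
      have hK0 : 0 ≤ max (Real.log (2 * M)) 0 := le_max_right _ _
      by_cases hlarge : 2 * M < ‖X 0 ω‖ ∧ 0 ≤ Real.log ‖X 0 ω‖
      · obtain ⟨hl, hl0⟩ := hlarge
        have hpos : 0 < ‖X 0 ω‖ := by linarith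
        have hR : ‖X 0 ω‖ / 2 ≤ nnDist (fun j : Fin n => X j ω) ⟨0, by omega⟩ (X 0 ω) := by
          by_contra! hlt
          have : ¬ (∀ j : Fin n, j ≠ ⟨0, by omega⟩ → ‖X 0 ω‖ / 2 ≤ ‖X 0 ω - X j ω‖) := by
            intro hall
            have : Nontrivial (Fin n) := Fin.nontrivial_iff_two_le.2 hn
            have : Nonempty {j : Fin n // j ≠ ⟨0, by omega⟩} := by
              obtain ⟨j, hj⟩ := exists_ne (⟨0, by omega⟩ : Fin n)
              exact ⟨⟨j, hj⟩⟩
            exact hlt.not_ge (le_ciInf fun j => hall j j.2)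
          refine this fun j hj => ?_
          have hjM := mem_closedBall_zero_iff.1 (hω j (by
            simp only [hS, Finset.mem_erase, Finset.mem_range]
            exact ⟨fun h => hj (Fin.ext h), j.2⟩))
          linarith [norm_sub_norm_le (X 0 ω) (X j ω)]
        have hT : ((n : ℝ) - 1) * (‖X 0 ω‖ / 2) ^ d * unitBallVolume d
            ≤ nnVolume X n ⟨0, by omega⟩ ω := by
          unfold nnVolume
          have : (0 : ℝ) ≤ (n : ℝ) - 1 := by linarith
          gcongr
        have hn1' : (0 : ℝ) < (n : ℝ) - 1 := by linarith
        have hlogT := Real.log_le_log (by positivity) hT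
        rw [mul_right_comm, Real.log_mul (by positivity) (by positivity), Real.log_pow,
          Real.log_div hpos.ne' (by norm_num)] at hlogT
        have habs := neg_abs_le (Real.log ((n - 1) * unitBallVolume d) - d * Real.log 2)
        have hdl : Real.log ‖X 0 ω‖ ≤ d * Real.log ‖X 0 ω‖ := le_mul_of_one_le_left hl0 hd1
        refine (ENNReal.ofReal_le_ofReal ?_).trans ENNReal.ofReal_add_le
        rw [max_eq_left hl0]
        linarith
      · refine le_add_self.trans' (ENNReal.ofReal_le_ofReal ?_)
        refine max_le ?_ (by positivity)
        rcases not_and_or.1 hlarge with h | h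
        · rcases (norm_nonneg (X 0 ω)).eq_or_lt with h0 | h0
          · rw [← h0, Real.log_zero]
            positivity
          · have := Real.log_le_log h0 (not_lt.1 h)
            linarith [le_max_left (Real.log (2 * M)) 0]
        · linarith
    · simp [hω]
  have hle := lintegral_mono (μ := P) hbound
  rw [hprod, lintegral_add_right _ measurable_const, top_le_iff, ENNReal.add_eq_top] at hle
  rcases hle with h | h
  · exact hfin h
  · simp at h

theorem expPos_estimateH_eq_top (hd : 1 ≤ d) (hf : IsProbDensity f) (hH : HasFiniteEntropy f)
    (hX : ∀ i, Measurable (X i)) (hindep : iIndepFun X P)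
    (hlaw : ∀ i, P.map (X i) = densityLaw f)
    (hlog : ∫⁻ ω, ENNReal.ofReal (max (Real.log ‖X 0 ω‖) 0) ∂P = ⊤) {n : ℕ} (hn : 2 ≤ n) :
    expPos P (estimateH X n) = ⊤ := by
  have := isProbabilityMeasure_densityLaw hf
  have hm : ∀ i : Fin n, Measurable fun ω => ENNReal.ofReal (-Real.log (nnVolume X n i ω)) :=
    fun i => (measurable_log_nnVolume hX i).neg.ennreal_ofReal
  have htop := expPos_log_nnVolume_eq_top hd hX hindep hlaw hlog hn
  by_contra hfin
  refine (lt_of_le_of_lt ?_ (?_ : ENNReal.ofReal n * (expPos P (estimateH X n)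
    + ENNReal.ofReal (-constCE)) + ∑ i : Fin n, expNeg P (fun ω => Real.log (nnVolume X n i ω))
      < ⊤)).ne htop
  · calc expPos P (fun ω => Real.log (nnVolume X n ⟨0, by omega⟩ ω))
        ≤ ∫⁻ ω, (ENNReal.ofReal n * (ENNReal.ofReal (estimateH X n ω)
            + ENNReal.ofReal (-constCE))
            + ∑ i : Fin n, ENNReal.ofReal (-Real.log (nnVolume X n i ω))) ∂P := by
          refine lintegral_mono fun ω => ?_
          have hn0 : (n : ℝ) ≠ 0 := by positivity
          have hsplit : Real.log (nnVolume X n ⟨0, by omega⟩ ω)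
              = n * (estimateH X n ω + -constCE)
                + ∑ i ∈ Finset.univ.erase ⟨0, by omega⟩, -Real.log (nnVolume X n i ω) := by
            rw [estimateH_eq, Finset.sum_neg_distrib,
              ← Finset.add_sum_erase _ _ (Finset.mem_univ (⟨0, by omega⟩ : Fin n))]
            field_simp
            ring
          beta_reduce
          rw [hsplit]
          refine ENNReal.ofReal_add_le.trans ?_
          gcongr
          · rw [ENNReal.ofReal_mul (by positivity)]
            gcongr
            exact ENNReal.ofReal_add_le
          · refine (ennreal_ofReal_sum_le _ _).trans ?_
            exact Finset.sum_le_sum_of_subset (Finset.erase_subset _ _)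
      _ = _ := by
          rw [lintegral_add_right _ (Finset.measurable_fun_sum _ fun i _ => hm i),
            lintegral_finsetSum _ fun i _ => hm i,
            lintegral_const_mul' _ _ ENNReal.ofReal_ne_top,
            lintegral_add_right _ measurable_const]
          simp [expNeg, expPos]
  · refine ENNReal.add_lt_top.2 ⟨ENNReal.mul_lt_top ENNReal.ofReal_lt_top
      (ENNReal.add_lt_top.2 ⟨lt_top_iff_ne_top.2 hfin, ENNReal.ofReal_lt_top⟩), ?_⟩
    exact ENNReal.sum_lt_top.2 fun i _ => expNeg_log_nnVolume_lt_top hd hf hH hX hindep hlaw hn i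

theorem expPos_le_lintegral_abs_sub_add (Y : Ω → ℝ) (a : ℝ) :
    expPos P Y ≤ ∫⁻ ω, ENNReal.ofReal |Y ω - a| ∂P + ENNReal.ofReal a := by
  calc expPos P Y ≤ ∫⁻ ω, (ENNReal.ofReal |Y ω - a| + ENNReal.ofReal a) ∂P := by
        refine lintegral_mono fun ω => (ENNReal.ofReal_le_ofReal ?_).trans ENNReal.ofReal_add_le
        linarith [le_abs_self (Y ω - a)]
    _ = _ := by
        rw [lintegral_add_right _ measurable_const]
        simp

end Expectation

theorem theorem2 {d : ℕ} (hd : 1 ≤ d)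
    (f : EuclideanSpace ℝ (Fin d) → ℝ) (hf : IsProbDensity f) (hH : HasFiniteEntropy f)
    {Ω : Type*} [MeasurableSpace Ω] (P : Measure Ω) [IsProbabilityMeasure P]
    (X : ℕ → Ω → EuclideanSpace ℝ (Fin d)) (hX : ∀ i, Measurable (X i))
    (hindep : iIndepFun X P)
    (hlaw : ∀ i, P.map (X i) = volume.withDensity (fun x => ENNReal.ofReal (f x))) :
    (Tendsto (fun n : ℕ => ∫⁻ ω, ENNReal.ofReal |estimateH X n ω - diffEntropy f| ∂P)
        atTop (𝓝 0) ↔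
      ∫⁻ ω, ENNReal.ofReal (max (Real.log ‖X 0 ω‖) 0) ∂P < ⊤) ∧
    (∀ n : ℕ, 2 ≤ n →
      ExpWellDefined P (estimateH X n) ∧ ⊥ < extExp P (estimateH X n)) ∧
    (∫⁻ ω, ENNReal.ofReal (max (Real.log ‖X 0 ω‖) 0) ∂P = ⊤ →
      ∀ n : ℕ, 2 ≤ n → extExp P (estimateH X n) = ⊤) := by
  have hneg : ∀ n : ℕ, 2 ≤ n → expNeg P (estimateH X n) < ⊤ := fun n hn =>
    expNeg_estimateH_lt_top hd hf hH hX hindep hlaw hn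
  refine ⟨⟨fun hlim => ?_, fun hlog => ?_⟩, fun n hn => ⟨Or.inr (hneg n hn),
    bot_lt_extExp (hneg n hn)⟩, fun hlog n hn => extExp_eq_top (hneg n hn)
      (expPos_estimateH_eq_top hd hf hH hX hindep hlaw hlog hn)⟩
  · by_contra hlog
    rw [lt_top_iff_ne_top, not_not] at hlog
    obtain ⟨n, hn1, hn2⟩ := ((hlim.eventually_lt_const ENNReal.zero_lt_top).and
      (eventually_ge_atTop 2)).exists
    have htop := expPos_estimateH_eq_top hd hf hH hX hindep hlaw hlog hn2
    have hle := expPos_le_lintegral_abs_sub_add (P := P) (estimateH X n) (diffEntropy f)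
    rw [htop] at hle
    exact (ENNReal.add_lt_top.2 ⟨hn1, ENNReal.ofReal_lt_top⟩).not_ge hle
  · refine tendsto_lintegral_estimateH_sub hd hf hH hX hindep hlaw ?_
    have hmap : ∫⁻ x, ENNReal.ofReal (max (Real.log ‖x‖) 0) ∂densityLaw f
        = ∫⁻ ω, ENNReal.ofReal (max (Real.log ‖X 0 ω‖) 0) ∂P := by
      rw [densityLaw, ← hlaw 0, lintegral_map (by fun_prop) (hX 0)]
    rwa [hmap]
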